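/- Let $(f(n))_{n\ge 1}$ be a sequence of integers that is strictly convex, i.e. $f(n+1)-f(n)<f(n+2)-f(n+1)$ for all $n\ge 1$. Suppose that for some real $\tau>0$ there is a constant $C$ such that $$\frac1N\sum_{n=1}^N |f(n)|\le C N^{\tau}$$ for all sufficiently large $N$. For $1/2<\alpha<1$ let $$\mathcal F_{f,\alpha}=\Bigl\{x\in[0,1]:\ \Bigl|\sum_{n=1}^N e^{2\pi i x f(n)}\Bigr|\ge N^{\alpha}\ \text{for infinitely many } N\in\mathbb N\Bigr\}.$$ Then, for every $\alpha\in(1/2,1)$, the Hausdorff dimension of $\mathcal F_{f,\alpha}$ satisfies $$\dim \mathcal F_{f,\alpha}\le \min\Bigl\{\frac{\tau+45/13-5\alpha}{\tau+1-\alpha},\ \inf_{k\ge 3,\ k\in\mathbb N}\frac{\tau-\alpha+2k-1+2^{-k+1}-2k\alpha}{\tau+1-\alpha}\Bigr\}.$$ -/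

import Mathlib

/-- The real sequence `f(1), f(2), …` is indexed by the positive integers; the value `f 0` is never
used. `expSum f x N` is the exponential sum `V_f(x; N) = ∑_{n=1}^N exp(2πi x f(n))`. -/
noncomputable def expSum (f : ℕ → ℝ) (x : ℝ) (N : ℕ) : ℂ :=
  ∑ n ∈ Finset.Icc 1 N, Complex.exp (2 * Real.pi * Complex.I * ((x * f n : ℝ) : ℂ))

/-- The set of `x` in the unit interval `[0, 1]` with `|V_f(x; N)| ≥ N^α` for infinitely many
positive integers `N`. -/
def largeSumSet (f : ℕ → ℝ) (α : ℝ) : Set ℝ :=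
  {x | x ∈ Set.Icc (0 : ℝ) 1 ∧ {N : ℕ | 1 ≤ N ∧ (N : ℝ) ^ α ≤ ‖expSum f x N‖}.Infinite}

/-- `(1/N) ∑_{n=1}^N |f(n)| ≤ C N^τ` for some constant `C` and all large enough `N`. -/
def HasAverageGrowth (f : ℕ → ℝ) (τ : ℝ) : Prop :=
  ∃ C : ℝ, ∃ N₀ : ℕ, 1 ≤ N₀ ∧ ∀ N : ℕ, N₀ ≤ N →
    (1 / (N : ℝ)) * ∑ n ∈ Finset.Icc 1 N, |f n| ≤ C * (N : ℝ) ^ τ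

/-- Strict convexity of the sequence `f(1), f(2), …`: the consecutive differences
`f(n+1) - f(n)`, `n ≥ 1`, are strictly increasing. -/
def IsStrictlyConvexSeq (f : ℕ → ℝ) : Prop :=
  ∀ n : ℕ, 1 ≤ n → f (n + 1) - f n < f (n + 2) - f (n + 1)

/-- `U₁(τ, α) = (τ + 45/13 - 5α) / (τ + 1 - α)`. -/
noncomputable def dimBoundOne (τ α : ℝ) : ℝ :=
  (τ + 45 / 13 - 5 * α) / (τ + 1 - α)

/-- `U₂(τ, α)`, an infimum over all integers `k ≥ 3`. For `1/2 < α < 1` and `τ > 0` the terms tend to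
infinity with `k`, so this is the infimum of a set of reals that is bounded below. -/
noncomputable def dimBoundTwo (τ α : ℝ) : ℝ :=
  ⨅ k : {k : ℕ // 3 ≤ k},
    (τ - α + 2 * (k : ℝ) - 1 + (2 : ℝ) ^ (-(k : ℝ) + 1) - 2 * (k : ℝ) * α) / (τ + 1 - α)

/-! A strictly convex sequence splits at its turning point into a decreasing and an increasing run.
On either run, a difference of two terms together with the distance of their indices determines the
terms, because g(m + h) - g(m) is strictly increasing in m for fixed h > 0. `HasDistinctGaps` keeps
exactly this property, for sets.

For such a set A, `card_popular_le` allows only about |A||B|²/t³ sums a + b with at least t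
representations. Dyadic decomposition turns this into energy bounds. Up to logarithms, E_{k+1}² ≲
|A|^{2(k+1)} E_k, so the 2k-th moment of the exponential sum over A has exponent 2k - 2 + 2^{1-k}
(`setMomentBound`). For k = 2, counting walks in the graph of popular differences improves 5/2 to
32/13 (`diffEnergy_pow_le`).

To pass from moments to dimension (`dimH_le_of_moment`), note that a partial sum of length at most
2^m has derivative O(2^{m(τ+1)}), so a value of size 2^{mα} persists on an interval of length about
2^{-m(τ+1-α)}. Chebyshev's inequality with moment exponent E then leaves about 2^{m(τ+1-α+E-2kα)}
such intervals. The maximum over all lengths N ≤ 2^m costs only factors of m, since [0, N) is a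
union of dyadic blocks, at most one of each size. A Borel–Cantelli covering gives dimension at most
1 + (E - 2kα)/(τ+1-α), and both bounds follow by inserting the two exponents. -/

open Filter MeasureTheory
open scoped Pointwise

/-! ### Popular sums of sets with distinct gaps -/

/-- The number of representations of `x` as a sum of an element of `A` and an element of `B`. -/
def repCount (A B : Finset ℤ) (x : ℤ) : ℕ := (A.filter fun a => x - a ∈ B).card

/-- Two pairs of elements of `A` with the same difference and with the same number of elements of
`A` between them coincide. The set of values of a monotone strictly convex sequence has this
property. -/
def HasDistinctGaps (A : Finset ℤ) : Prop :=
  ∀ a ∈ A, ∀ a' ∈ A, ∀ c ∈ A, ∀ c' ∈ A, a < a' → c < c' → a' - a = c' - c →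
    (A ∩ Finset.Ico a a').card = (A ∩ Finset.Ico c c').card → a = c

lemma exists_next (R : Finset ℤ) : ∃ s : ℤ → ℤ, ∀ a ∈ R, (∃ c ∈ R, a < c) →
    s a ∈ R ∧ a < s a ∧ ∀ c ∈ R, a < c → s a ≤ c := by
  have : ∀ a : ℤ, ∃ b, (a ∈ R → (∃ c ∈ R, a < c) → b ∈ R ∧ a < b ∧ ∀ c ∈ R, a < c → b ≤ c) := by
    intro a
    by_cases h : ∃ c ∈ R, a < c
    · have hne : (R.filter (a < ·)).Nonempty := by
        obtain ⟨c, hc, hac⟩ := h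
        exact ⟨c, by simp [hc, hac]⟩
      have hm := Finset.min'_mem _ hne
      rw [Finset.mem_filter] at hm
      refine ⟨_, fun _ _ => ⟨hm.1, hm.2, fun c hc hac => Finset.min'_le _ _ (by simp [hc, hac])⟩⟩
    · exact ⟨0, fun _ h' => absurd h' h⟩
  choose s hs using this
  exact ⟨s, fun a ha h => hs a ha h⟩

/-- The intervals are disjoint and each wide one holds more than 8|D|/t points of D, so at most t/8
of them are wide. -/
lemma eight_mul_card_wide_le {R D : Finset ℤ} {s : ℤ → ℤ} {t : ℕ} (hD : D.Nonempty)
    (hdis : (R : Set ℤ).PairwiseDisjoint fun a => Finset.Ico a (s a)) :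
    8 * (R.filter fun a => ¬ t * (D ∩ Finset.Ico a (s a)).card ≤ 8 * D.card).card ≤ t := by
  set W := R.filter fun a => ¬ t * (D ∩ Finset.Ico a (s a)).card ≤ 8 * D.card with hW
  have h1 : ∑ a ∈ W, (D ∩ Finset.Ico a (s a)).card ≤ D.card := by
    rw [← Finset.card_biUnion]
    · exact Finset.card_le_card (Finset.biUnion_subset.2 fun a _ => Finset.inter_subset_left)
    · intro a ha b hb hab
      exact (hdis (Finset.mem_filter.1 ha).1 (Finset.mem_filter.1 hb).1 hab).mono
        Finset.inter_subset_right Finset.inter_subset_right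
  have h2 : W.card * (8 * D.card) ≤ ∑ a ∈ W, t * (D ∩ Finset.Ico a (s a)).card := by
    rw [← smul_eq_mul]
    refine Finset.card_nsmul_le_sum _ _ _ fun a ha => ?_
    exact (not_le.1 (Finset.mem_filter.1 ha).2).le
  rw [← Finset.mul_sum] at h2
  have h3 : D.card * (8 * W.card) ≤ D.card * t := by nlinarith
  exact Nat.le_of_mul_le_mul_left h3 hD.card_pos

/-- Among the at least t - 1 pairs of consecutive elements of R, at most t/8 are wide for D₁ and at
most t/8 for D₂. What remains is at least t - 1 - t/4 ≥ t/4, which is where t ≥ 2 enters. -/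
lemma card_close_pairs {R D₁ D₂ : Finset ℤ} {t : ℕ} (ht : 2 ≤ t) (hR : t ≤ R.card)
    (hD₁ : D₁.Nonempty) (hD₂ : D₂.Nonempty) :
    t ≤ 4 * ((R ×ˢ R).filter fun p => p.1 < p.2 ∧
      t * (D₁ ∩ Finset.Ico p.1 p.2).card ≤ 8 * D₁.card ∧
      t * (D₂ ∩ Finset.Ico p.1 p.2).card ≤ 8 * D₂.card).card := by
  obtain ⟨s, hs⟩ := exists_next R
  set R' := R.filter fun a => ∃ c ∈ R, a < c with hR'
  have hne : R.Nonempty := Finset.card_pos.1 (by omega)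
  have hcard : R.card ≤ R'.card + 1 := by
    have : R ⊆ insert (R.max' hne) R' := by
      intro a ha
      rcases (R.le_max' a ha).eq_or_lt with h | h
      · simp [← h]
      · exact Finset.mem_insert_of_mem (Finset.mem_filter.2 ⟨ha, _, R.max'_mem hne, h⟩)
    exact (Finset.card_le_card this).trans (Finset.card_insert_le _ _)
  have hs' : ∀ a ∈ R', s a ∈ R ∧ a < s a ∧ ∀ c ∈ R, a < c → s a ≤ c := fun a ha =>
    hs a (Finset.mem_filter.1 ha).1 (Finset.mem_filter.1 ha).2
  have hdis : (R' : Set ℤ).PairwiseDisjoint fun a => Finset.Ico a (s a) := by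
    have key : ∀ a ∈ R', ∀ b ∈ R', a < b → Disjoint (Finset.Ico a (s a)) (Finset.Ico b (s b)) := by
      intro a ha b hb hab
      have := (hs' a ha).2.2 b (Finset.mem_filter.1 hb).1 hab
      rw [Finset.disjoint_left]
      intro y hy hy'
      rw [Finset.mem_Ico] at hy hy'
      omega
    intro a ha b hb hab
    rcases lt_or_gt_of_ne hab with h | h
    · exact key a ha b hb h
    · exact (key b hb a ha h).symm
  have h1 := eight_mul_card_wide_le (t := t) hD₁ hdis
  have h2 := eight_mul_card_wide_le (t := t) hD₂ hdis
  have h3 := Finset.card_filter_add_card_filter_not (s := R')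
    (fun a => t * (D₁ ∩ Finset.Ico a (s a)).card ≤ 8 * D₁.card)
  set G₁ := R'.filter fun a => t * (D₁ ∩ Finset.Ico a (s a)).card ≤ 8 * D₁.card with hG₁
  have h4 := Finset.card_filter_add_card_filter_not (s := G₁)
    (fun a => t * (D₂ ∩ Finset.Ico a (s a)).card ≤ 8 * D₂.card)
  have h5 : (G₁.filter fun a => ¬ t * (D₂ ∩ Finset.Ico a (s a)).card ≤ 8 * D₂.card).card ≤
      (R'.filter fun a => ¬ t * (D₂ ∩ Finset.Ico a (s a)).card ≤ 8 * D₂.card).card :=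
    Finset.card_le_card (Finset.filter_subset_filter _ (Finset.filter_subset _ _))
  have h6 : (G₁.filter fun a => t * (D₂ ∩ Finset.Ico a (s a)).card ≤ 8 * D₂.card).card ≤
      ((R ×ˢ R).filter fun p => p.1 < p.2 ∧
      t * (D₁ ∩ Finset.Ico p.1 p.2).card ≤ 8 * D₁.card ∧
      t * (D₂ ∩ Finset.Ico p.1 p.2).card ≤ 8 * D₂.card).card := by
    refine Finset.card_le_card_of_injOn (fun a => (a, s a)) ?_ ?_
    · intro a ha
      obtain ⟨ha1, ha2⟩ := Finset.mem_filter.1 ha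
      obtain ⟨ha3, ha4⟩ := Finset.mem_filter.1 ha1
      obtain ⟨h7, h8, -⟩ := hs' a ha3
      simp only [Finset.coe_filter, Finset.mem_product, Set.mem_ofPred_eq]
      exact ⟨⟨(Finset.mem_filter.1 ha3).1, h7⟩, h8, ha4, ha2⟩
    · intro a _ b _ hab
      exact (Prod.ext_iff.1 hab).1
  omega

lemma repCount_le_card (A B : Finset ℤ) (x : ℤ) : repCount A B x ≤ A.card :=
  Finset.card_filter_le _ _

lemma sum_repCount_le (A B X : Finset ℤ) : ∑ x ∈ X, repCount A B x ≤ A.card * B.card := by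
  have : ∑ x ∈ X, repCount A B x = ∑ a ∈ A, (X.filter fun x => x - a ∈ B).card := by
    simp only [repCount]
    exact Finset.sum_card_bipartiteAbove_eq_sum_card_bipartiteBelow fun x a => x - a ∈ B
  rw [this, ← smul_eq_mul]
  refine Finset.sum_le_card_nsmul _ _ _ fun a _ => ?_
  refine Finset.card_le_card_of_injOn (fun x => x - a) ?_ ?_
  · intro x hx
    exact (Finset.mem_filter.1 hx).2
  · intro x _ y _ h
    simpa using h

/-- A set with distinct gaps has few popular sums with any other set. -/
theorem card_popular_le {A B X : Finset ℤ} (hA : HasDistinctGaps A) {t : ℕ}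
    (hX : ∀ x ∈ X, t ≤ repCount A B x) : X.card * t ^ 3 ≤ 256 * (A.card * B.card ^ 2) := by
  rcases Nat.lt_or_ge t 2 with ht | ht
  · have h1 : X.card * t ≤ A.card * B.card := by
      rw [← smul_eq_mul]
      exact (Finset.card_nsmul_le_sum _ _ _ hX).trans (sum_repCount_le A B X)
    have h2 : B.card ≤ B.card ^ 2 := Nat.le_self_pow two_ne_zero _
    have h3 : A.card * B.card ≤ A.card * B.card ^ 2 := Nat.mul_le_mul_left _ h2
    interval_cases t <;> omega
  -- T consists of triples (x, a, a') where x = a + b = a' + b', a < a', and few points of A and of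
  -- B lie between the respective summands. Each x contributes at least t/4 of them.
  set T : Finset (Σ _ : ℤ, ℤ × ℤ) := X.sigma fun x =>
    ((A.filter fun a => x - a ∈ B) ×ˢ (A.filter fun a => x - a ∈ B)).filter fun p => p.1 < p.2 ∧
      t * (A ∩ Finset.Ico p.1 p.2).card ≤ 8 * A.card ∧
      t * (B ∩ Finset.Ioc (x - p.2) (x - p.1)).card ≤ 8 * B.card with hT
  have hlow : X.card * t ≤ 4 * T.card := by
    rw [hT, Finset.card_sigma, Finset.mul_sum, ← smul_eq_mul]
    refine Finset.card_nsmul_le_sum _ _ _ fun x hx => ?_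
    have hx' := hX x hx
    have hne : (A.filter fun a => x - a ∈ B).Nonempty :=
      Finset.card_pos.1 (lt_of_lt_of_le (by omega) hx')
    obtain ⟨a, ha⟩ := hne
    rw [Finset.mem_filter] at ha
    have h := card_close_pairs (D₁ := A) (D₂ := B.image (x - ·)) ht hx' ⟨a, ha.1⟩
      (Finset.Nonempty.image ⟨_, ha.2⟩ _)
    have hinj : Function.Injective fun b : ℤ => x - b := fun b c h => by simpa using h
    have himg : ∀ c d : ℤ, (B.image (x - ·) ∩ Finset.Ico c d).card =
        (B ∩ Finset.Ioc (x - d) (x - c)).card := by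
      intro c d
      rw [← Finset.card_image_of_injective (B ∩ Finset.Ioc (x - d) (x - c)) hinj]
      congr 1
      ext y
      simp only [Finset.mem_inter, Finset.mem_image, Finset.mem_Ico, Finset.mem_Ioc]
      constructor
      · rintro ⟨⟨b, hb, rfl⟩, h1, h2⟩
        exact ⟨b, ⟨hb, by omega, by omega⟩, rfl⟩
      · rintro ⟨b, ⟨hb, h1, h2⟩, rfl⟩
        exact ⟨⟨b, hb, rfl⟩, by omega, by omega⟩
    simp only [himg, Finset.card_image_of_injective _ hinj] at h
    exact h
  -- A triple is encoded by b = x - a, the number of points of B in (b', b] and the number of points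
  -- of A in [a, a'). The first two recover b', hence a' - a = b - b'; the third then recovers a by
  -- the distinct gaps.
  have hupp : T.card ≤ (B ×ˢ Finset.Icc 1 (8 * B.card / t) ×ˢ
      Finset.Icc 1 (8 * A.card / t)).card := by
    refine Finset.card_le_card_of_injOn (fun p => (p.1 - p.2.1,
      (B ∩ Finset.Ioc (p.1 - p.2.2) (p.1 - p.2.1)).card, (A ∩ Finset.Ico p.2.1 p.2.2).card)) ?_ ?_
    · rintro ⟨x, a, a'⟩ hp
      simp only [hT, Finset.coe_sigma, Set.mem_sigma_iff, Finset.mem_coe, Finset.mem_filter,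
        Finset.mem_product] at hp
      obtain ⟨hx, ⟨⟨ha, hb⟩, ha', hb'⟩, hlt, h1, h2⟩ := hp
      simp only [Finset.coe_product, Set.mem_prod, Finset.mem_coe, Finset.mem_Icc]
      refine ⟨hb, ⟨Finset.card_pos.2 ⟨x - a, ?_⟩, ?_⟩, Finset.card_pos.2 ⟨a, ?_⟩, ?_⟩
      · simp [hb, hlt]
      · rw [Nat.le_div_iff_mul_le (by omega)]; linarith
      · simp [ha, hlt]
      · rw [Nat.le_div_iff_mul_le (by omega)]; linarith
    · rintro ⟨x, a, a'⟩ hp ⟨y, c, c'⟩ hq heq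
      simp only [hT, Finset.coe_sigma, Set.mem_sigma_iff, Finset.mem_coe, Finset.mem_filter,
        Finset.mem_product] at hp hq
      obtain ⟨hx, ⟨⟨ha, hb⟩, ha', hb'⟩, hlt, -, -⟩ := hp
      obtain ⟨hy, ⟨⟨hc, hd⟩, hc', hd'⟩, hlt', -, -⟩ := hq
      simp only [Prod.mk.injEq] at heq
      obtain ⟨h1, h2, h3⟩ := heq
      rw [← h1] at h2
      have key : ∀ u ∈ B, ∀ v ∈ B, u < v → v < x - a →
          (B ∩ Finset.Ioc v (x - a)).card < (B ∩ Finset.Ioc u (x - a)).card := by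
        intro u hu v hv huv hva
        refine Finset.card_lt_card ⟨Finset.inter_subset_inter_left
          (Finset.Ioc_subset_Ioc_left huv.le), fun h => ?_⟩
        have := h (show v ∈ _ by simp [hv, huv, hva.le])
        simp at this
      have h4 : x - a' = y - c' := by
        rcases lt_trichotomy (x - a') (y - c') with h | h | h
        · have := key _ hb' _ hd' h (by omega); omega
        · exact h
        · have := key _ hd' _ hb' h (by omega); omega
      have h5 := hA a ha a' ha' c hc c' hc' hlt hlt' (by omega) h3
      subst h5
      have : x = y := by omega
      subst this
      have : a' = c' := by omega
      subst this
      rfl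
  rw [Finset.card_product, Finset.card_product, Nat.card_Icc, Nat.card_Icc, Nat.add_sub_cancel,
    Nat.add_sub_cancel] at hupp
  have h1 : 8 * B.card / t * t ≤ 8 * B.card := Nat.div_mul_le_self _ _
  have h2 : 8 * A.card / t * t ≤ 8 * A.card := Nat.div_mul_le_self _ _
  calc X.card * t ^ 3 = X.card * t * t ^ 2 := by ring
    _ ≤ 4 * (B.card * ((8 * B.card / t) * (8 * A.card / t))) * t ^ 2 := by exact Nat.mul_le_mul_right _ (hlow.trans (Nat.mul_le_mul_left _ hupp))
    _ = 4 * B.card * ((8 * B.card / t * t) * (8 * A.card / t * t)) := by ring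
    _ ≤ 4 * B.card * ((8 * B.card) * (8 * A.card)) := by gcongr
    _ = 256 * (A.card * B.card ^ 2) := by ring

/-! ### Dyadic pigeonholing and the energy between two sets -/

/-- Pigeonhole over the K dyadic classes of values of r. The value 0 lies in no class, so g has to
vanish there. -/
lemma sum_le_mul_dyadic {ι : Type*} (X : Finset ι) (r g : ι → ℕ) (K : ℕ)
    (hr : ∀ x ∈ X, r x < 2 ^ K) (hg : ∀ x ∈ X, r x = 0 → g x = 0) :
    ∃ i, ∑ x ∈ X, g x ≤ K * ∑ x ∈ X.filter (fun x => 2 ^ i ≤ r x ∧ r x < 2 ^ (i + 1)), g x := by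
  by_contra! h
  have h1 : ∑ x ∈ X, g x ≤ ∑ i ∈ Finset.range K,
      ∑ x ∈ X.filter (fun x => 2 ^ i ≤ r x ∧ r x < 2 ^ (i + 1)), g x := by
    simp only [Finset.sum_filter]
    rw [Finset.sum_comm]
    refine Finset.sum_le_sum fun x hx => ?_
    by_cases h0 : r x = 0
    · simp [hg x hx h0]
    · have h2 : Nat.log 2 (r x) < K := Nat.log_lt_of_lt_pow h0 (hr x hx)
      have h3 : (2 ^ Nat.log 2 (r x) ≤ r x ∧ r x < 2 ^ (Nat.log 2 (r x) + 1)) :=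
        ⟨Nat.pow_log_le_self 2 h0, Nat.lt_pow_succ_log_self one_lt_two _⟩
      refine le_trans ?_ (Finset.single_le_sum (fun _ _ => Nat.zero_le _) (Finset.mem_range.2 h2))
      rw [if_pos h3]
  rcases Nat.eq_zero_or_pos K with rfl | hK
  · simpa using (h 0).trans_le h1
  · have h2 : ∑ i ∈ Finset.range K,
        K * ∑ x ∈ X.filter (fun x => 2 ^ i ≤ r x ∧ r x < 2 ^ (i + 1)), g x
        < ∑ i ∈ Finset.range K, ∑ x ∈ X, g x :=
      Finset.sum_lt_sum_of_nonempty ⟨0, Finset.mem_range.2 hK⟩ fun i _ => h i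
    rw [← Finset.mul_sum, Finset.sum_const, Finset.card_range, smul_eq_mul] at h2
    exact absurd (Nat.mul_le_mul_left K h1) (not_le.2 h2)

/-- The number of dyadic intervals needed to cover `1, …, n`. -/
def dyadicLen (n : ℕ) : ℕ := Nat.log 2 n + 1

lemma lt_two_pow_dyadicLen {m n : ℕ} (h : m ≤ n) : m < 2 ^ dyadicLen n :=
  h.trans_lt (Nat.lt_pow_succ_log_self one_lt_two _)

lemma sum_dyadic_le {ι : Type*} (X : Finset ι) (r : ι → ℕ) (K m : ℕ) (hm : m ≠ 0)
    (hr : ∀ x ∈ X, r x < 2 ^ K) :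
    ∃ i, ∑ x ∈ X, r x ^ m ≤
      K * ((X.filter (fun x => 2 ^ i ≤ r x ∧ r x < 2 ^ (i + 1))).card * (2 * 2 ^ i) ^ m) := by
  obtain ⟨i, hi⟩ := sum_le_mul_dyadic X r (fun x => r x ^ m) K hr (fun x _ h => by simp [h, hm])
  refine ⟨i, hi.trans (Nat.mul_le_mul_left _ ?_)⟩
  rw [← smul_eq_mul (_ : ℕ) (_ ^ m)]
  refine Finset.sum_le_card_nsmul _ _ _ fun x hx => ?_
  refine Nat.pow_le_pow_left ?_ _
  have := (Finset.mem_filter.1 hx).2.2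
  rw [pow_succ] at this
  omega

/-- The number of solutions of `a + b = a' + b'` is at most about `|A| |B| ^ (3 / 2)`. -/
theorem sq_sum_repCount_sq_le {A : Finset ℤ} (hA : HasDistinctGaps A) (B X : Finset ℤ) :
    (∑ x ∈ X, repCount A B x ^ 2) ^ 2 ≤
      4096 * (dyadicLen A.card ^ 2 * A.card ^ 2 * B.card ^ 3) := by
  obtain ⟨i, hi⟩ := sum_dyadic_le X (repCount A B) (dyadicLen A.card) 2 two_ne_zero
    (fun x _ => lt_two_pow_dyadicLen (repCount_le_card A B x))
  set Y := X.filter (fun x => 2 ^ i ≤ repCount A B x ∧ repCount A B x < 2 ^ (i + 1)) with hY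
  set t := 2 ^ i
  have hYt : ∀ x ∈ Y, t ≤ repCount A B x := fun x hx => (Finset.mem_filter.1 hx).2.1
  have h1 : Y.card * t ≤ A.card * B.card := by
    rw [← smul_eq_mul]
    exact (Finset.card_nsmul_le_sum _ _ _ hYt).trans (sum_repCount_le A B Y)
  have h2 := card_popular_le hA hYt
  -- The square of |Y|t² is the product of |Y|t, bounded by counting all pairs, and |Y|t³, bounded
  -- by the popular sums estimate.
  calc _ ≤ (dyadicLen A.card * (Y.card * (2 * t) ^ 2)) ^ 2 := Nat.pow_le_pow_left hi _
    _ = 16 * dyadicLen A.card ^ 2 * ((Y.card * t) * (Y.card * t ^ 3)) := by ring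
    _ ≤ 16 * dyadicLen A.card ^ 2 * ((A.card * B.card) * (256 * (A.card * B.card ^ 2))) := by gcongr
    _ = _ := by ring

/-! ### Energies of higher order -/

/-- The number of representations of `x` as an ordered sum of `k` elements of `A`. -/
def sumCount (A : Finset ℤ) : ℕ → ℤ → ℕ
  | 0, x => if x = 0 then 1 else 0
  | k + 1, x => ∑ a ∈ A, sumCount A k (x - a)

/-- The `k`-fold sumset. -/
def iteratedSumset (A : Finset ℤ) : ℕ → Finset ℤ
  | 0 => {0}
  | k + 1 => A + iteratedSumset A k

lemma mem_iteratedSumset {A : Finset ℤ} {k : ℕ} {x : ℤ} (h : sumCount A k x ≠ 0) :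
    x ∈ iteratedSumset A k := by
  induction k generalizing x with
  | zero => by_contra h'; simp_all [sumCount, iteratedSumset]
  | succ k ih =>
    obtain ⟨a, ha, hne⟩ := Finset.exists_ne_zero_of_sum_ne_zero h
    exact Finset.mem_add.2 ⟨a, ha, x - a, ih hne, by ring⟩

lemma sum_sumCount_le (A : Finset ℤ) (k : ℕ) (X : Finset ℤ) :
    ∑ x ∈ X, sumCount A k x ≤ A.card ^ k := by
  induction k generalizing X with
  | zero =>
    simp only [sumCount, pow_zero, Finset.sum_ite_eq']
    split_ifs <;> simp
  | succ k ih =>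
    simp only [sumCount]
    rw [Finset.sum_comm, pow_succ', ← smul_eq_mul]
    refine Finset.sum_le_card_nsmul _ _ _ fun a _ => ?_
    have := ih (X.image (· - a))
    rwa [Finset.sum_image (fun x _ y _ h => by simpa using h)] at this

lemma sumCount_le (A : Finset ℤ) (k : ℕ) (x : ℤ) : sumCount A k x ≤ A.card ^ k := by
  simpa using sum_sumCount_le A k {x}

/-- The number of solutions of `a₁ + ⋯ + aₖ = b₁ + ⋯ + bₖ` in `A`. -/
def sumEnergy (A : Finset ℤ) (k : ℕ) : ℕ := ∑ x ∈ iteratedSumset A k, sumCount A k x ^ 2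

lemma sum_sumCount_sq_le (A : Finset ℤ) (k : ℕ) (X : Finset ℤ) :
    ∑ x ∈ X, sumCount A k x ^ 2 ≤ sumEnergy A k := by
  refine Finset.sum_le_sum_of_ne_zero fun x _ h => mem_iteratedSumset fun h0 => h ?_
  simp [h0]

/-- The k-fold representation function is cut into dyadic level sets B_j, so that a (k+1)-fold sum
becomes a sum of an element of A and one of some B_j, to which the two-set energy bound applies. -/
theorem sq_sumEnergy_succ_le {A : Finset ℤ} (hA : HasDistinctGaps A) (k : ℕ) :
    sumEnergy A (k + 1) ^ 2 ≤ 2 ^ 16 * dyadicLen (A.card ^ k) ^ 4 * dyadicLen A.card ^ 2 *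
      A.card ^ (2 * (k + 1)) * sumEnergy A k := by
  set K := dyadicLen (A.card ^ k)
  set B : ℕ → Finset ℤ := fun j => (iteratedSumset A k).filter
    fun y => 2 ^ j ≤ sumCount A k y ∧ sumCount A k y < 2 ^ (j + 1) with hB
  have h1 : ∀ y, sumCount A k y ≤ ∑ j ∈ Finset.range K, 2 ^ (j + 1) * if y ∈ B j then 1 else 0 := by
    intro y
    by_cases h0 : sumCount A k y = 0
    · simp [h0]
    have h2 : Nat.log 2 (sumCount A k y) < K :=
      Nat.log_lt_of_lt_pow h0 (lt_two_pow_dyadicLen (sumCount_le A k y))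
    have h4 := Nat.lt_pow_succ_log_self one_lt_two (sumCount A k y)
    have h3 : y ∈ B (Nat.log 2 (sumCount A k y)) := Finset.mem_filter.2 ⟨mem_iteratedSumset h0,
        Nat.pow_log_le_self 2 h0, h4⟩
    refine le_trans ?_ (Finset.single_le_sum (fun _ _ => Nat.zero_le _) (Finset.mem_range.2 h2))
    rw [if_pos h3, mul_one]
    exact h4.le
  have h2 : ∀ x, sumCount A (k + 1) x ≤
      ∑ j ∈ Finset.range K, 2 ^ (j + 1) * repCount A (B j) x := by
    intro x
    simp only [sumCount]
    refine (Finset.sum_le_sum fun a _ => h1 (x - a)).trans_eq ?_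
    rw [Finset.sum_comm]
    refine Finset.sum_congr rfl fun j _ => ?_
    rw [← Finset.mul_sum, repCount, Finset.card_filter]
  set u : ℕ → ℕ := fun j => (2 ^ (j + 1)) ^ 2 *
    ∑ x ∈ iteratedSumset A (k + 1), repCount A (B j) x ^ 2 with hu
  have h3 : sumEnergy A (k + 1) ≤ K * ∑ j ∈ Finset.range K, u j := by
    rw [sumEnergy, Finset.mul_sum]
    simp only [hu, Finset.mul_sum]
    rw [Finset.sum_comm]
    refine Finset.sum_le_sum fun x _ => ?_
    refine (Nat.pow_le_pow_left (h2 x) 2).trans ?_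
    refine (sq_sum_le_card_mul_sum_sq).trans_eq ?_
    rw [Finset.card_range, Finset.mul_sum]
    simp only [mul_pow, Nat.cast_id]
  -- The factor 2^{4j}|B_j|³ is regrouped as (|B_j|2^j)²(|B_j|2^{2j}): the first factor is
  -- controlled by the total mass |A|^k, the second by the k-fold energy.
  have h4 : ∀ j ∈ Finset.range K, u j ^ 2 ≤
      2 ^ 16 * dyadicLen A.card ^ 2 * A.card ^ (2 * (k + 1)) * sumEnergy A k := by
    intro j _
    have h5 : (B j).card * 2 ^ j ≤ A.card ^ k := by
      rw [← smul_eq_mul]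
      exact (Finset.card_nsmul_le_sum _ _ _ fun x hx => (Finset.mem_filter.1 hx).2.1).trans
        (sum_sumCount_le A k (B j))
    have h6 : (B j).card * (2 ^ j) ^ 2 ≤ sumEnergy A k := by
      rw [← smul_eq_mul]
      exact (Finset.card_nsmul_le_sum _ _ _ fun x hx =>
        Nat.pow_le_pow_left (Finset.mem_filter.1 hx).2.1 2).trans (sum_sumCount_sq_le A k (B j))
    calc u j ^ 2 = 16 * (2 ^ j) ^ 4 *
          (∑ x ∈ iteratedSumset A (k + 1), repCount A (B j) x ^ 2) ^ 2 := by
          simp only [hu]; ring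
      _ ≤ 16 * (2 ^ j) ^ 4 * (4096 * (dyadicLen A.card ^ 2 * A.card ^ 2 * (B j).card ^ 3)) :=
          Nat.mul_le_mul_left _ (sq_sum_repCount_sq_le hA _ _)
      _ = 2 ^ 16 * dyadicLen A.card ^ 2 * A.card ^ 2 * ((B j).card * (2 ^ j)) ^ 2 *
          ((B j).card * (2 ^ j) ^ 2) := by ring
      _ ≤ 2 ^ 16 * dyadicLen A.card ^ 2 * A.card ^ 2 * (A.card ^ k) ^ 2 * sumEnergy A k := by
          gcongr
      _ = _ := by ring
  calc sumEnergy A (k + 1) ^ 2 ≤ (K * ∑ j ∈ Finset.range K, u j) ^ 2 := Nat.pow_le_pow_left h3 _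
    _ = K ^ 2 * (∑ j ∈ Finset.range K, u j) ^ 2 := by ring
    _ ≤ K ^ 2 * ((Finset.range K).card * ∑ j ∈ Finset.range K, u j ^ 2) := by
        gcongr; exact sq_sum_le_card_mul_sum_sq
    _ ≤ K ^ 2 * (K * (K * (2 ^ 16 * dyadicLen A.card ^ 2 * A.card ^ (2 * (k + 1)) *
          sumEnergy A k))) := by
        rw [Finset.card_range]
        gcongr
        refine (Finset.sum_le_card_nsmul _ _ _ h4).trans_eq ?_
        rw [Finset.card_range, smul_eq_mul]
    _ = _ := by ring

/-! ### The additive energy exponent 32/13 -/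

/-- A lower bound for walks of length three. Vertices of degree below S/(4|V|), a quarter of the
average, carry at most S/4 of the degree sum S, so at least S/2 of the total weight joins vertices
of larger degree, where d(x)d(y) ≥ S²/(16|V|²). -/
lemma sum_degree_pow_three_le {ι : Type*} (V : Finset ι) (M : ι → ι → ℕ) (d : ι → ℕ)
    (hd : ∀ x ∈ V, d x = ∑ y ∈ V, M x y) (hsymm : ∀ x y, M x y = M y x) :
    (∑ x ∈ V, d x) ^ 3 ≤ 32 * V.card ^ 2 * ∑ x ∈ V, ∑ y ∈ V, M x y * (d x * d y) := by
  classical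
  rcases V.eq_empty_or_nonempty with rfl | hV
  · simp
  have hV' := hV.card_pos
  set S := ∑ x ∈ V, d x with hS
  set l : ι → ℕ := fun x => if 4 * V.card * d x < S then 1 else 0 with hl
  have h1 : ∀ x y, S ^ 2 * M x y ≤
      16 * V.card ^ 2 * (M x y * (d x * d y)) + S ^ 2 * (M x y * l x) + S ^ 2 * (M x y * l y) := by
    intro x y
    by_cases hx : 4 * V.card * d x < S
    · simp only [hl, hx, if_true, mul_one]; omega
    by_cases hy : 4 * V.card * d y < S
    · simp only [hl, hy, if_true, mul_one]; omega
    have : S ^ 2 * M x y ≤ 16 * V.card ^ 2 * (M x y * (d x * d y)) := by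
      calc S ^ 2 * M x y = S * S * M x y := by ring
        _ ≤ (4 * V.card * d x) * (4 * V.card * d y) * M x y := by
          gcongr <;> omega
        _ = _ := by ring
    omega
  have h2 : 4 * ∑ x ∈ V, d x * l x ≤ S := by
    have : V.card * (4 * ∑ x ∈ V, d x * l x) ≤ V.card * S := by
      rw [← smul_eq_mul V.card S, ← mul_assoc, Finset.mul_sum]
      refine Finset.sum_le_card_nsmul _ _ _ fun x _ => ?_
      by_cases hx : 4 * V.card * d x < S
      · simp only [hl, hx, if_true, mul_one]; linarith
      · simp [hl, hx]
    exact Nat.le_of_mul_le_mul_left this hV'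
  have h3 : ∑ x ∈ V, ∑ y ∈ V, M x y * l x = ∑ x ∈ V, d x * l x :=
    Finset.sum_congr rfl fun x hx => by rw [← Finset.sum_mul, hd x hx]
  have h4 : ∑ x ∈ V, ∑ y ∈ V, M x y * l y = ∑ x ∈ V, d x * l x := by
    rw [Finset.sum_comm, ← h3]
    simp only [hsymm]
  have h5 : ∑ x ∈ V, ∑ y ∈ V, S ^ 2 * M x y = S ^ 3 := by
    simp only [← Finset.mul_sum]
    rw [← Finset.sum_congr rfl hd]; ring
  have h6 := Finset.sum_le_sum fun x (_ : x ∈ V) => Finset.sum_le_sum fun y (_ : y ∈ V) => h1 x y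
  simp only [Finset.sum_add_distrib] at h6
  rw [h5] at h6
  simp only [← Finset.mul_sum] at h6
  rw [h3, h4] at h6
  have h7 : S ^ 2 * (4 * ∑ x ∈ V, d x * l x) ≤ S ^ 2 * S := Nat.mul_le_mul_left _ h2
  have h8 : S ^ 2 * S = S ^ 3 := by ring
  nlinarith

/-- Since G is a Gram matrix, both sides are sums over c of expressions in the vector Mu_c: on the
left the square of the sum of its entries, on the right the sum of their squares. Cauchy–Schwarz
compares them. -/
lemma sum_degree_gram_le {ι κ : Type*} (V : Finset ι) (C : Finset κ) (M : ι → ι → ℕ) (d : ι → ℕ)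
    (hd : ∀ y ∈ V, d y = ∑ x ∈ V, M x y) (u : κ → ι → ℕ) (G : ι → ι → ℕ)
    (hG : ∀ y ∈ V, ∀ z ∈ V, G y z = ∑ c ∈ C, u c y * u c z) :
    ∑ y ∈ V, ∑ z ∈ V, G y z * (d y * d z) ≤
      V.card * ∑ x ∈ V, ∑ y ∈ V, ∑ z ∈ V, M x y * M x z * G y z := by
  have h1 : ∑ y ∈ V, ∑ z ∈ V, G y z * (d y * d z) =
      ∑ c ∈ C, (∑ x ∈ V, ∑ y ∈ V, M x y * u c y) ^ 2 := by
    have : ∀ c, ∑ x ∈ V, ∑ y ∈ V, M x y * u c y = ∑ y ∈ V, d y * u c y := by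
      intro c
      rw [Finset.sum_comm]
      exact Finset.sum_congr rfl fun y hy => by rw [← Finset.sum_mul, hd y hy]
    simp only [this, sq, Finset.sum_mul_sum]
    rw [Finset.sum_comm (s := C)]
    refine Finset.sum_congr rfl fun y hy => ?_
    rw [Finset.sum_comm (s := C)]
    refine Finset.sum_congr rfl fun z hz => ?_
    rw [hG y hy z hz, Finset.sum_mul]
    exact Finset.sum_congr rfl fun c _ => by ring
  have h2 : ∑ x ∈ V, ∑ y ∈ V, ∑ z ∈ V, M x y * M x z * G y z =
      ∑ c ∈ C, ∑ x ∈ V, (∑ y ∈ V, M x y * u c y) ^ 2 := by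
    rw [Finset.sum_comm (s := C)]
    refine Finset.sum_congr rfl fun x _ => ?_
    simp only [sq, Finset.sum_mul_sum]
    rw [Finset.sum_comm (s := C)]
    refine Finset.sum_congr rfl fun y hy => ?_
    rw [Finset.sum_comm (s := C)]
    refine Finset.sum_congr rfl fun z hz => ?_
    rw [hG y hy z hz, Finset.mul_sum]
    exact Finset.sum_congr rfl fun c _ => by ring
  rw [h1, h2, Finset.mul_sum]
  exact Finset.sum_le_sum fun c _ => sq_sum_le_card_mul_sum_sq

/-- The number of representations of `x` as a difference of two elements of `A`. -/
def diffCount (A : Finset ℤ) (x : ℤ) : ℕ := (A.filter fun a => a - x ∈ A).card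

lemma diffCount_eq_repCount (A : Finset ℤ) (x : ℤ) : diffCount A x = repCount A (-A) x := by
  simp [diffCount, repCount, Finset.mem_neg']

lemma diffCount_neg (A : Finset ℤ) (x : ℤ) : diffCount A (-x) = diffCount A x := by
  refine Finset.card_bij' (fun a _ => a + x) (fun a _ => a - x) ?_ ?_ ?_ ?_ <;>
    simp +contextual

lemma diffCount_le_card (A : Finset ℤ) (x : ℤ) : diffCount A x ≤ A.card :=
  Finset.card_filter_le _ _

lemma sum_sub_eq_sum_diffCount {R : Type*} [Semiring R] (A : Finset ℤ) (g : ℤ → R) :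
    ∑ x ∈ A, ∑ y ∈ A, g (x - y) = ∑ z ∈ A - A, diffCount A z * g z := by
  have h1 : ∀ x ∈ A, ∑ y ∈ A, g (x - y) = ∑ z ∈ A - A, if x - z ∈ A then g z else 0 := by
    intro x hx
    rw [← Finset.sum_filter]
    refine Finset.sum_bij' (fun y _ => x - y) (fun z _ => x - z) ?_ ?_ ?_ ?_ ?_
    · intro y hy
      simp [hy, Finset.sub_mem_sub hx hy]
    · intro z hz
      exact (Finset.mem_filter.1 hz).2
    all_goals simp
  rw [Finset.sum_congr rfl h1, Finset.sum_comm]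
  refine Finset.sum_congr rfl fun z _ => ?_
  rw [diffCount, ← Finset.sum_filter, Finset.sum_const, nsmul_eq_mul]

/-- The set of differences with about `2 ^ i` representations. -/
def diffLevel (A : Finset ℤ) (i : ℕ) : Finset ℤ :=
  (A - A).filter fun x => 2 ^ i ≤ diffCount A x ∧ diffCount A x < 2 ^ (i + 1)

lemma mem_sub_of_diffCount_ne_zero {A : Finset ℤ} {x : ℤ} (h : diffCount A x ≠ 0) :
    x ∈ A - A := by
  obtain ⟨a, ha⟩ := Finset.card_ne_zero.1 h
  rw [Finset.mem_filter] at ha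
  exact Finset.mem_sub.2 ⟨a, ha.1, a - x, ha.2, by ring⟩

lemma mem_diffLevel {A : Finset ℤ} {i : ℕ} {x : ℤ} :
    x ∈ diffLevel A i ↔ 2 ^ i ≤ diffCount A x ∧ diffCount A x < 2 ^ (i + 1) := by
  refine ⟨fun h => (Finset.mem_filter.1 h).2, fun h => Finset.mem_filter.2 ⟨?_, h⟩⟩
  refine mem_sub_of_diffCount_ne_zero fun h0 => ?_
  have : 0 < 2 ^ i := by positivity
  omega

lemma neg_mem_diffLevel {A : Finset ℤ} {i : ℕ} {x : ℤ} :
    -x ∈ diffLevel A i ↔ x ∈ diffLevel A i := by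
  rw [mem_diffLevel, mem_diffLevel, diffCount_neg]

lemma card_diffLevel_le {A : Finset ℤ} (hA : HasDistinctGaps A) (i : ℕ) :
    (diffLevel A i).card * (2 ^ i) ^ 3 ≤ 256 * A.card ^ 3 := by
  refine (card_popular_le (B := -A) hA fun x hx => ?_).trans_eq ?_
  · rw [← diffCount_eq_repCount]
    exact (mem_diffLevel.1 hx).1
  · rw [Finset.card_neg]; ring

/-- The additive energy of `A`. -/
def diffEnergy (A : Finset ℤ) : ℕ := ∑ x ∈ A - A, diffCount A x ^ 2

lemma card_diffLevel_mul_sq_le (A : Finset ℤ) (i : ℕ) :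
    (diffLevel A i).card * (2 ^ i) ^ 2 ≤ diffEnergy A := by
  rw [← smul_eq_mul]
  refine (Finset.card_nsmul_le_sum _ _ _ fun x hx =>
    Nat.pow_le_pow_left (mem_diffLevel.1 hx).1 2).trans ?_
  exact Finset.sum_le_sum_of_subset (Finset.filter_subset _ _)

lemma sum_diffCount_cube_le {A : Finset ℤ} (hA : HasDistinctGaps A) :
    ∑ x ∈ A - A, diffCount A x ^ 3 ≤ 2048 * (dyadicLen A.card * A.card ^ 3) := by
  obtain ⟨i, hi⟩ := sum_dyadic_le (A - A) (diffCount A) (dyadicLen A.card) 3 three_ne_zero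
    (fun x _ => lt_two_pow_dyadicLen (diffCount_le_card A x))
  calc _ ≤ _ := hi
    _ = 8 * dyadicLen A.card * ((diffLevel A i).card * (2 ^ i) ^ 3) := by rw [diffLevel]; ring
    _ ≤ 8 * dyadicLen A.card * (256 * A.card ^ 3) :=
        Nat.mul_le_mul_left _ (card_diffLevel_le hA i)
    _ = _ := by ring

/-- Writing q = a - a' in at least t ways turns each pair (p, q) with q - p in U into t coincidences
a - p = a' + (q - p) between A - P and A + U. Cauchy–Schwarz separates these into two energies. -/
lemma pow_four_card_diff_le {A : Finset ℤ} (hA : HasDistinctGaps A) {P U : Finset ℤ} {t : ℕ}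
    (hP : ∀ x ∈ P, t ≤ diffCount A x) :
    (t * ((P ×ˢ P).filter fun p => p.2 - p.1 ∈ U).card) ^ 4 ≤
      2 ^ 24 * (dyadicLen A.card ^ 4 * A.card ^ 4 * P.card ^ 3 * U.card ^ 3) := by
  set Q := (P ×ˢ P).filter fun p => p.2 - p.1 ∈ U with hQ
  have h1 : t * Q.card ≤ ∑ w ∈ A - P, repCount A (-P) w * repCount A U w := by
    have h2 : t * Q.card ≤ (Q.sigma fun p => A.filter fun a => a - p.2 ∈ A).card := by
      rw [Finset.card_sigma, mul_comm, ← smul_eq_mul]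
      exact Finset.card_nsmul_le_sum _ _ _ fun p hp =>
        hP _ (Finset.mem_product.1 (Finset.mem_filter.1 hp).1).2
    refine h2.trans ?_
    have h3 : ∑ w ∈ A - P, repCount A (-P) w * repCount A U w =
        ((A - P).sigma fun w => (A.filter fun a => w - a ∈ -P) ×ˢ
          (A.filter fun a => w - a ∈ U)).card := by
      rw [Finset.card_sigma]
      exact Finset.sum_congr rfl fun w _ => by rw [Finset.card_product]; rfl
    rw [h3]
    refine Finset.card_le_card_of_injOn (fun p => ⟨p.2 - p.1.1, p.2, p.2 - p.1.2⟩) ?_ ?_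
    · rintro ⟨⟨p, q⟩, a⟩ h
      simp only [hQ, Finset.coe_sigma, Set.mem_sigma_iff, Finset.mem_coe, Finset.mem_filter,
        Finset.mem_product] at h
      obtain ⟨⟨⟨hp, hq⟩, hu⟩, ha, ha'⟩ := h
      simp only [Finset.coe_sigma, Set.mem_sigma_iff, Finset.mem_coe, Finset.mem_filter,
        Finset.mem_product, Finset.mem_neg']
      refine ⟨Finset.sub_mem_sub ha hp, ⟨ha, by simpa using hp⟩, ha', ?_⟩
      convert hu using 1; ring
    · rintro ⟨⟨p, q⟩, a⟩ _ ⟨⟨p', q'⟩, a'⟩ _ h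
      simp only [Sigma.mk.injEq, heq_eq_eq, Prod.mk.injEq] at h
      obtain ⟨h1, h2, h3⟩ := h
      subst h2
      have : p = p' := by omega
      subst this
      have : q = q' := by omega
      subst this
      rfl
  have h2 := sq_sum_repCount_sq_le hA (-P) (A - P)
  have h3 := sq_sum_repCount_sq_le hA U (A - P)
  rw [Finset.card_neg] at h2
  calc (t * Q.card) ^ 4 ≤ (∑ w ∈ A - P, repCount A (-P) w * repCount A U w) ^ 4 :=
        Nat.pow_le_pow_left h1 4
    _ = ((∑ w ∈ A - P, repCount A (-P) w * repCount A U w) ^ 2) ^ 2 := by ring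
    _ ≤ ((∑ w ∈ A - P, repCount A (-P) w ^ 2) * ∑ w ∈ A - P, repCount A U w ^ 2) ^ 2 := by
        gcongr; exact Finset.sum_mul_sq_le_sq_mul_sq _ _ _
    _ = (∑ w ∈ A - P, repCount A (-P) w ^ 2) ^ 2 * (∑ w ∈ A - P, repCount A U w ^ 2) ^ 2 := by ring
    _ ≤ _ := Nat.mul_le_mul h2 h3
    _ = _ := by ring

lemma sum_diffCount_sub_sq_le {A : Finset ℤ} (hA : HasDistinctGaps A) {P : Finset ℤ} {t : ℕ}
    (hP : ∀ x ∈ P, t ≤ diffCount A x) :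
    t ^ 4 * (∑ p ∈ P ×ˢ P, diffCount A (p.2 - p.1) ^ 2) ^ 4 ≤
      2 ^ 48 * (dyadicLen A.card ^ 8 * A.card ^ 10 * P.card ^ 3 * diffEnergy A) := by
  obtain ⟨j, hj⟩ := sum_dyadic_le (P ×ˢ P) (fun p => diffCount A (p.2 - p.1)) (dyadicLen A.card) 2
    two_ne_zero (fun x _ => lt_two_pow_dyadicLen (diffCount_le_card A _))
  have h1 := pow_four_card_diff_le hA (U := diffLevel A j) hP
  simp only [mem_diffLevel] at h1
  set Q := ((P ×ˢ P).filter fun p =>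
    2 ^ j ≤ diffCount A (p.2 - p.1) ∧ diffCount A (p.2 - p.1) < 2 ^ (j + 1)).card
  have h2 := card_diffLevel_mul_sq_le A j
  have h3 := card_diffLevel_le hA j
  set L := dyadicLen A.card
  set N := A.card
  set T := 2 ^ j
  -- With u = |U| and T the size of the level, T⁸u³ = (uT²)(uT³)²; the factors are bounded by the
  -- energy and by the popular differences estimate.
  set u := (diffLevel A j).card
  calc _ ≤ t ^ 4 * (L * (Q * (2 * T) ^ 2)) ^ 4 := by gcongr
    _ = 2 ^ 8 * L ^ 4 * T ^ 8 * (t * Q) ^ 4 := by ring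
    _ ≤ 2 ^ 8 * L ^ 4 * T ^ 8 * (2 ^ 24 * (L ^ 4 * N ^ 4 * P.card ^ 3 * u ^ 3)) := by gcongr
    _ = 2 ^ 32 * (L ^ 8 * N ^ 4 * P.card ^ 3) * (u * T ^ 2) * (u * T ^ 3) ^ 2 := by ring
    _ ≤ 2 ^ 32 * (L ^ 8 * N ^ 4 * P.card ^ 3) * diffEnergy A * (256 * N ^ 3) ^ 2 := by gcongr
    _ = _ := by ring

/-- Expanding the square and exchanging summations gives the sum over x, y in A of the squared
number of p in P with x - p and y - p in A. Each such p represents x - y as a difference, which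
leads to the third moment of `diffCount`. -/
lemma sum_card_triple_sq_le (A P : Finset ℤ) :
    ∑ p ∈ P ×ˢ P, (A.filter fun x => x - p.1 ∈ A ∧ x - p.2 ∈ A).card ^ 2 ≤
      ∑ x ∈ A - A, diffCount A x ^ 3 := by
  have h1 : ∀ x ∈ A, ∀ y ∈ A, (∑ p ∈ P, if x - p ∈ A ∧ y - p ∈ A then 1 else 0) ≤
      diffCount A (x - y) := by
    intro x _ y _
    rw [← Finset.card_filter]
    refine Finset.card_le_card_of_injOn (fun p => x - p) ?_ ?_
    · intro p hp
      simp only [Finset.coe_filter, Set.mem_ofPred_eq] at hp ⊢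
      refine ⟨hp.2.1, ?_⟩
      convert hp.2.2 using 1; ring
    · intro p _ q _ h
      simpa using h
  have h2 : ∑ p ∈ P ×ˢ P, (A.filter fun x => x - p.1 ∈ A ∧ x - p.2 ∈ A).card ^ 2 =
      ∑ x ∈ A, ∑ y ∈ A, (∑ p ∈ P, if x - p ∈ A ∧ y - p ∈ A then 1 else 0) ^ 2 := by
    have h3 : ∀ p ∈ P ×ˢ P, (A.filter fun x => x - p.1 ∈ A ∧ x - p.2 ∈ A).card ^ 2 =
        ∑ w ∈ A ×ˢ A, (if w.1 - p.1 ∈ A ∧ w.1 - p.2 ∈ A then 1 else 0) *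
          (if w.2 - p.1 ∈ A ∧ w.2 - p.2 ∈ A then 1 else 0) := by
      intro p _
      rw [Finset.card_filter, sq, Finset.sum_mul_sum, Finset.sum_product]
    have h4 : ∀ w ∈ A ×ˢ A, (∑ p ∈ P, if w.1 - p ∈ A ∧ w.2 - p ∈ A then 1 else 0) ^ 2 =
        ∑ p ∈ P ×ˢ P, (if w.1 - p.1 ∈ A ∧ w.1 - p.2 ∈ A then 1 else 0) *
          (if w.2 - p.1 ∈ A ∧ w.2 - p.2 ∈ A then 1 else 0) := by
      intro w _
      rw [sq, Finset.sum_mul_sum, Finset.sum_product]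
      refine Finset.sum_congr rfl fun p _ => Finset.sum_congr rfl fun q _ => ?_
      simp only [← ite_and, mul_ite, mul_one, mul_zero]
      exact if_congr (by tauto) rfl rfl
    rw [Finset.sum_congr rfl h3, Finset.sum_comm, ← Finset.sum_congr rfl h4, Finset.sum_product]
  rw [h2]
  calc _ ≤ ∑ x ∈ A, ∑ y ∈ A, diffCount A (x - y) ^ 2 := by
        refine Finset.sum_le_sum fun x hx => Finset.sum_le_sum fun y hy => ?_
        exact Nat.pow_le_pow_left (h1 x hx y hy) 2
    _ = _ := by
        rw [sum_sub_eq_sum_diffCount A fun z => diffCount A z ^ 2]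
        exact Finset.sum_congr rfl fun z _ => by rw [Nat.cast_id]; ring

/-- A set with distinct gaps has additive energy at most about `|A| ^ (32 / 13)`. -/
theorem diffEnergy_pow_le {A : Finset ℤ} (hA : HasDistinctGaps A) :
    diffEnergy A ^ 26 ≤ 2 ^ 234 * (dyadicLen A.card ^ 39 * A.card ^ 64) := by
  obtain ⟨i, hi⟩ := sum_dyadic_le (A - A) (diffCount A) (dyadicLen A.card) 2 two_ne_zero
    (fun x _ => lt_two_pow_dyadicLen (diffCount_le_card A x))
  set P := diffLevel A i with hP
  -- The level P carries the energy up to a logarithm: the energy is at most about |P|t². The graph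
  -- below joins x and y when x - y lies in P.
  set t := 2 ^ i with ht
  set M : ℤ → ℤ → ℕ := fun x y => if x - y ∈ P then 1 else 0 with hM
  have hPt : ∀ x ∈ P, t ≤ diffCount A x := fun x hx => (mem_diffLevel.1 hx).1
  have hsymm : ∀ x y, M x y = M y x := by
    intro x y
    have : x - y ∈ P ↔ y - x ∈ P := by rw [← neg_sub, neg_mem_diffLevel]
    simp only [hM, this]
  set d : ℤ → ℕ := fun x => ∑ y ∈ A, M x y with hd
  set σ := ∑ x ∈ A, ∑ y ∈ A, ∑ z ∈ A, M x y * M x z * diffCount A (y - z) with hσ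
  have hS : t * P.card ≤ ∑ x ∈ A, d x := by
    simp only [hd, hM]
    rw [sum_sub_eq_sum_diffCount A fun z => if z ∈ P then 1 else 0]
    simp only [mul_ite, mul_one, mul_zero]
    rw [← Finset.sum_filter, mul_comm, ← smul_eq_mul]
    refine (Finset.card_nsmul_le_sum _ _ _ hPt).trans (Finset.sum_le_sum_of_subset fun x hx => ?_)
    exact Finset.mem_filter.2 ⟨(Finset.mem_filter.1 hx).1, hx⟩
  have hwalk := sum_degree_pow_three_le A M d (fun _ _ => rfl) hsymm
  -- The Gram structure: `diffCount A (y - z)` counts the shifts c for which y + c and z + c both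
  -- lie in A.
  have hgram := sum_degree_gram_le A (A - A) M d
    (fun y _ => Finset.sum_congr rfl fun x _ => hsymm y x)
    (fun c y => if y + c ∈ A then 1 else 0) (fun y z => diffCount A (y - z)) (by
      intro y hy z _
      simp only [← ite_and, mul_ite, mul_one, mul_zero]
      rw [← Finset.card_filter, diffCount]
      refine Finset.card_bij' (fun a _ => a - y) (fun c _ => y + c) ?_ ?_ ?_ ?_
      · intro a ha
        rw [Finset.mem_filter] at ha ⊢
        refine ⟨Finset.sub_mem_sub ha.1 hy, ?_⟩
        constructor
        · convert ha.2 using 1; ring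
        · convert ha.1 using 1; ring
      · intro c hc
        rw [Finset.mem_filter] at hc ⊢
        refine ⟨hc.2.2, ?_⟩
        convert hc.2.1 using 1; ring
      all_goals simp)
  have hMG : t * ∑ x ∈ A, ∑ y ∈ A, M x y * (d x * d y) ≤
      ∑ y ∈ A, ∑ z ∈ A, diffCount A (y - z) * (d y * d z) := by
    simp only [Finset.mul_sum, ← mul_assoc]
    refine Finset.sum_le_sum fun y _ => Finset.sum_le_sum fun z _ => ?_
    gcongr
    by_cases h : y - z ∈ P
    · simpa [hM, h] using hPt _ h
    · simp [hM, h]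
  have hlow : t ^ 4 * P.card ^ 3 ≤ 32 * A.card ^ 3 * σ := by
    calc t ^ 4 * P.card ^ 3 = t * (t * P.card) ^ 3 := by ring
      _ ≤ t * (32 * A.card ^ 2 * ∑ x ∈ A, ∑ y ∈ A, M x y * (d x * d y)) :=
          Nat.mul_le_mul_left _ ((Nat.pow_le_pow_left hS 3).trans hwalk)
      _ = 32 * A.card ^ 2 * (t * ∑ x ∈ A, ∑ y ∈ A, M x y * (d x * d y)) := by ring
      _ ≤ 32 * A.card ^ 2 * (A.card * σ) := Nat.mul_le_mul_left _ (hMG.trans hgram)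
      _ = _ := by ring
  -- Substituting p = x - y and q = x - z gives y - z = q - p and leaves, for each (p, q), the
  -- number of x in A with x - p and x - q in A.
  have hσle : σ ≤ ∑ p ∈ P ×ˢ P, (A.filter fun x => x - p.1 ∈ A ∧ x - p.2 ∈ A).card *
      diffCount A (p.2 - p.1) := by
    have h1 : ∀ x ∈ A, ∑ y ∈ A, ∑ z ∈ A, M x y * M x z * diffCount A (y - z) =
        ∑ p ∈ P ×ˢ P, (if x - p.1 ∈ A ∧ x - p.2 ∈ A then 1 else 0) * diffCount A (p.2 - p.1) := by
      intro x _
      rw [← Finset.sum_product']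
      simp only [hM, ← ite_and, ite_mul, mul_ite, one_mul, mul_one, zero_mul, mul_zero]
      rw [← Finset.sum_filter, ← Finset.sum_filter]
      refine Finset.sum_bij' (fun w _ => (x - w.1, x - w.2)) (fun w _ => (x - w.1, x - w.2))
        ?_ ?_ ?_ ?_ ?_
      · intro w hw
        simp only [Finset.mem_filter, Finset.mem_product, sub_sub_cancel] at hw ⊢
        tauto
      · intro w hw
        simp only [Finset.mem_filter, Finset.mem_product, sub_sub_cancel] at hw ⊢
        tauto
      · simp
      · simp
      · intro w _
        congr 1; ring
    rw [hσ, Finset.sum_congr rfl h1, Finset.sum_comm]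
    refine le_of_eq (Finset.sum_congr rfl fun p _ => ?_)
    rw [← Finset.sum_mul, Finset.card_filter]
  have hupp : σ ^ 2 ≤ (∑ x ∈ A - A, diffCount A x ^ 3) *
      ∑ p ∈ P ×ˢ P, diffCount A (p.2 - p.1) ^ 2 :=
    (Nat.pow_le_pow_left hσle 2).trans ((Finset.sum_mul_sq_le_sq_mul_sq _ _ _).trans
      (Nat.mul_le_mul_right _ (sum_card_triple_sq_le A P)))
  have hE3 := sum_diffCount_cube_le hA
  have hG := sum_diffCount_sub_sq_le hA hPt
  have hcard := card_diffLevel_le hA i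
  change diffEnergy A ≤ dyadicLen A.card * (P.card * (2 * t) ^ 2) at hi
  rw [← hP, ← ht] at hcard
  set G := ∑ p ∈ P ×ˢ P, diffCount A (p.2 - p.1) ^ 2
  set L := dyadicLen A.card
  set N := A.card
  set p := P.card
  set E := diffEnergy A
  -- The eighth power of `hlow` matches the fourth power of `hupp` and brings in G⁴; the extra t⁴ is
  -- what `hG` needs. The common factor p³ is cancelled below.
  have h1 : p ^ 3 * (t ^ 36 * p ^ 21) ≤ p ^ 3 * (2 ^ 132 * (L ^ 12 * N ^ 46 * E)) := by
    calc p ^ 3 * (t ^ 36 * p ^ 21) = t ^ 4 * (t ^ 4 * p ^ 3) ^ 8 := by ring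
      _ ≤ t ^ 4 * (32 * N ^ 3 * σ) ^ 8 := by gcongr
      _ = 2 ^ 40 * N ^ 24 * t ^ 4 * (σ ^ 2) ^ 4 := by ring
      _ ≤ 2 ^ 40 * N ^ 24 * t ^ 4 * (2048 * (L * N ^ 3) * G) ^ 4 := by
          gcongr; exact hupp.trans (Nat.mul_le_mul_right _ hE3)
      _ = 2 ^ 84 * N ^ 36 * L ^ 4 * (t ^ 4 * G ^ 4) := by ring
      _ ≤ 2 ^ 84 * N ^ 36 * L ^ 4 * (2 ^ 48 * (L ^ 8 * N ^ 10 * p ^ 3 * E)) := by gcongr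
      _ = _ := by ring
  rcases Nat.eq_zero_or_pos E with hE | hE
  · simp [hE]
  have hp : 0 < p ^ 3 := by
    refine pow_pos (Nat.pos_of_ne_zero fun h0 => ?_) 3
    rw [h0] at hi
    omega
  have h2 := Nat.le_of_mul_le_mul_left h1 hp
  -- The exponents are balanced by (pt²)²⁷ = (t³⁶p²¹)(pt³)⁶. One factor E cancels, leaving E²⁶ ≲
  -- N⁶⁴.
  have h3 : E * E ^ 26 ≤ E * (2 ^ 234 * (L ^ 39 * N ^ 64)) := by
    calc E * E ^ 26 = E ^ 27 := by ring
      _ ≤ (L * (p * (2 * t) ^ 2)) ^ 27 := Nat.pow_le_pow_left hi _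
      _ = 2 ^ 54 * L ^ 27 * (t ^ 36 * p ^ 21) * (p * t ^ 3) ^ 6 := by ring
      _ ≤ 2 ^ 54 * L ^ 27 * (2 ^ 132 * (L ^ 12 * N ^ 46 * E)) * (256 * N ^ 3) ^ 6 := by gcongr
      _ = _ := by ring
  exact Nat.le_of_mul_le_mul_left h3 hE

/-! ### Moments of exponential sums -/

/-- The character `x ↦ exp (2πi x n)`. -/
noncomputable def unitExp (x : ℝ) (n : ℤ) : ℂ :=
  Complex.exp (2 * Real.pi * Complex.I * ((x * n : ℝ) : ℂ))

lemma unitExp_add (x : ℝ) (m n : ℤ) : unitExp x (m + n) = unitExp x m * unitExp x n := by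
  rw [unitExp, unitExp, unitExp, ← Complex.exp_add]
  congr 1; push_cast; ring

lemma unitExp_zero (x : ℝ) : unitExp x 0 = 1 := by simp [unitExp]

lemma norm_unitExp (x : ℝ) (n : ℤ) : ‖unitExp x n‖ = 1 := by
  rw [unitExp, show 2 * (Real.pi : ℂ) * Complex.I * ((x * n : ℝ) : ℂ) =
    ((2 * Real.pi * (x * n) : ℝ) : ℂ) * Complex.I by push_cast; ring]
  exact Complex.norm_exp_ofReal_mul_I _

lemma star_unitExp (x : ℝ) (n : ℤ) : starRingEnd ℂ (unitExp x n) = unitExp x (-n) := by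
  have h1 : unitExp x n * unitExp x (-n) = 1 := by
    rw [← unitExp_add, add_neg_cancel, unitExp_zero]
  have h2 : unitExp x n * starRingEnd ℂ (unitExp x n) = 1 := by
    rw [Complex.mul_conj, Complex.normSq_eq_norm_sq, norm_unitExp]; simp
  have h3 : unitExp x n ≠ 0 := left_ne_zero_of_mul_eq_one h1
  exact mul_left_cancel₀ h3 (h2.trans h1.symm)

lemma continuous_unitExp (n : ℤ) : Continuous fun x => unitExp x n := by
  unfold unitExp; fun_prop

lemma integral_unitExp (n : ℤ) : ∫ x in (0 : ℝ)..1, unitExp x n = if n = 0 then 1 else 0 := by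
  split_ifs with h
  · simp [h, unitExp_zero]
  · have hc : 2 * (Real.pi : ℂ) * Complex.I * n ≠ 0 := by
      simp [h, Real.pi_ne_zero]
    have : ∀ x : ℝ, unitExp x n = Complex.exp (2 * (Real.pi : ℂ) * Complex.I * n * x) := by
      intro x; rw [unitExp]; congr 1; push_cast; ring
    simp only [this]
    rw [integral_exp_mul_complex hc]
    have h1 : Complex.exp (2 * (Real.pi : ℂ) * Complex.I * n * (1 : ℝ)) = 1 := by
      rw [Complex.exp_eq_one_iff]
      exact ⟨n, by push_cast; ring⟩
    rw [h1]; simp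

/-- Parseval's identity for trigonometric polynomials. -/
lemma integral_norm_sq_trigPoly (T : Finset ℤ) (c : ℤ → ℕ) :
    ∫ x in (0 : ℝ)..1, ‖∑ n ∈ T, (c n : ℂ) * unitExp x n‖ ^ 2 = ((∑ n ∈ T, c n ^ 2 : ℕ) : ℝ) := by
  have h1 : ∀ x : ℝ, ((‖∑ n ∈ T, (c n : ℂ) * unitExp x n‖ ^ 2 : ℝ) : ℂ) =
      ∑ m ∈ T, ∑ n ∈ T, (c m * c n : ℂ) * unitExp x (m - n) := by
    intro x
    rw [← Complex.normSq_eq_norm_sq, ← Complex.mul_conj, map_sum, Finset.sum_mul_sum]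
    refine Finset.sum_congr rfl fun m _ => Finset.sum_congr rfl fun n _ => ?_
    rw [map_mul, star_unitExp, sub_eq_add_neg, unitExp_add, Complex.conj_natCast]; ring
  have h2 : ((∫ x in (0 : ℝ)..1, ‖∑ n ∈ T, (c n : ℂ) * unitExp x n‖ ^ 2 : ℝ) : ℂ) =
      ((∑ n ∈ T, c n ^ 2 : ℕ) : ℂ) := by
    rw [← intervalIntegral.integral_ofReal]
    simp only [h1]
    rw [intervalIntegral.integral_finsetSum]
    · push_cast
      refine Finset.sum_congr rfl fun m hm => ?_
      rw [intervalIntegral.integral_finsetSum]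
      · simp only [intervalIntegral.integral_const_mul, integral_unitExp, sub_eq_zero]
        simp [hm, sq]
      · intro n _
        exact ((continuous_unitExp _).const_mul _).intervalIntegrable _ _
    · intro m _
      refine Continuous.intervalIntegrable ?_ _ _
      exact continuous_finsetSum _ fun n _ => (continuous_unitExp _).const_mul _
  exact_mod_cast h2

lemma sum_unitExp_pow (A : Finset ℤ) (k : ℕ) (x : ℝ) :
    (∑ a ∈ A, unitExp x a) ^ k =
      ∑ n ∈ iteratedSumset A k, (sumCount A k n : ℂ) * unitExp x n := by
  induction k with
  | zero => simp [iteratedSumset, sumCount, unitExp_zero]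
  | succ k ih =>
    rw [pow_succ', ih, Finset.sum_mul]
    simp only [sumCount, Nat.cast_sum, Finset.sum_mul]
    rw [Finset.sum_comm]
    refine Finset.sum_congr rfl fun a ha => ?_
    rw [Finset.mul_sum]
    have h1 : (iteratedSumset A k).image (a + ·) ⊆ iteratedSumset A (k + 1) := by
      intro y hy
      obtain ⟨n, hn, rfl⟩ := Finset.mem_image.1 hy
      exact Finset.add_mem_add ha hn
    rw [← Finset.sum_subset h1, Finset.sum_image fun _ _ _ _ h => by simpa using h]
    · refine Finset.sum_congr rfl fun n _ => ?_
      rw [unitExp_add, add_sub_cancel_left]; ring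
    · intro y _ hy
      have : sumCount A k (y - a) = 0 := by
        by_contra h0
        exact hy (Finset.mem_image.2 ⟨y - a, mem_iteratedSumset h0, by ring⟩)
      simp [this]

lemma integral_norm_pow_eq_sumEnergy (A : Finset ℤ) (k : ℕ) :
    ∫ x in (0 : ℝ)..1, ‖∑ a ∈ A, unitExp x a‖ ^ (2 * k) = (sumEnergy A k : ℝ) := by
  rw [sumEnergy, ← integral_norm_sq_trigPoly]
  simp only [← sum_unitExp_pow, norm_pow, ← pow_mul, mul_comm 2 k]

/-- The fourth power is |S·S̄|², and the coefficients of S·S̄ are difference counts; this matches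
the energy bounded in `diffEnergy_pow_le`. -/
lemma integral_norm_pow_four_eq_diffEnergy (A : Finset ℤ) :
    ∫ x in (0 : ℝ)..1, ‖∑ a ∈ A, unitExp x a‖ ^ (2 * 2) = (diffEnergy A : ℝ) := by
  rw [diffEnergy, ← integral_norm_sq_trigPoly]
  congr 1 with x
  have : (∑ a ∈ A, unitExp x a) * starRingEnd ℂ (∑ a ∈ A, unitExp x a) =
      ∑ n ∈ A - A, (diffCount A n : ℂ) * unitExp x n := by
    rw [← sum_sub_eq_sum_diffCount, map_sum, Finset.sum_mul_sum]
    simp only [star_unitExp, sub_eq_add_neg, unitExp_add]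
  rw [← this, norm_mul, RCLike.norm_conj]
  ring

lemma exists_dyadicLen_le {ε : ℝ} (hε : 0 < ε) :
    ∃ C : ℝ, 1 ≤ C ∧ ∀ n : ℕ, 1 ≤ n → (dyadicLen n : ℝ) ≤ C * (n : ℝ) ^ ε := by
  have hl : 0 < Real.log 2 := Real.log_pos one_lt_two
  refine ⟨1 / (ε * Real.log 2) + 1, le_add_of_nonneg_left (by positivity), fun n hn => ?_⟩
  have hn' : (1 : ℝ) ≤ n := by exact_mod_cast hn
  have h1 : (1 : ℝ) ≤ (n : ℝ) ^ ε := Real.one_le_rpow hn' hε.le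
  have h2 : (Nat.log 2 n : ℝ) ≤ Real.log n / Real.log 2 := by
    have := Real.natLog_le_logb n 2
    rwa [Real.logb] at this
  have h3 := Real.log_le_rpow_div (x := n) (by positivity) hε
  have h4 : (Nat.log 2 n : ℝ) ≤ 1 / (ε * Real.log 2) * (n : ℝ) ^ ε := by
    refine h2.trans ?_
    rw [div_le_iff₀ hl]
    refine h3.trans_eq ?_
    field_simp
  rw [dyadicLen]; push_cast
  linarith

/-- The `2k`-th moments of the exponential sums over sets with distinct gaps are at most
`|A| ^ (E + ε)`. -/
def SetMomentBound (k : ℕ) (E : ℝ) : Prop :=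
  ∀ ε : ℝ, 0 < ε → ∃ C : ℝ, 0 ≤ C ∧ ∀ A : Finset ℤ, HasDistinctGaps A → 1 ≤ A.card →
    ∫ x in (0 : ℝ)..1, ‖∑ a ∈ A, unitExp x a‖ ^ (2 * k) ≤ C * (A.card : ℝ) ^ (E + ε)

theorem setMomentBound_two : SetMomentBound 2 (32 / 13) := by
  intro ε hε
  -- The logarithm occurs to the power 39 in a bound for the 26th power, and 39 · (2ε/3) = 26ε.
  obtain ⟨C, hC, hL⟩ := exists_dyadicLen_le (ε := 2 * ε / 3) (by positivity)
  refine ⟨2 ^ 234 * C ^ 39, by positivity, fun A hA hA1 => ?_⟩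
  rw [integral_norm_pow_four_eq_diffEnergy]
  have h1 : (diffEnergy A : ℝ) ^ 26 ≤
      2 ^ 234 * ((dyadicLen A.card : ℝ) ^ 39 * (A.card : ℝ) ^ 64) := by
    exact_mod_cast diffEnergy_pow_le hA
  have h2 := hL _ hA1
  set N : ℝ := (A.card : ℝ) with hN
  have hN0 : 0 < N := by rw [hN]; exact_mod_cast hA1
  have h3 : (1 : ℝ) ≤ 2 ^ 234 * C ^ 39 := one_le_mul_of_one_le_of_one_le (by norm_num)
    (one_le_pow₀ hC)
  refine (pow_le_pow_iff_left₀ (by positivity) (by positivity) (n := 26) (by norm_num)).1 ?_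
  calc (diffEnergy A : ℝ) ^ 26 ≤ _ := h1
    _ ≤ 2 ^ 234 * ((C * N ^ (2 * ε / 3)) ^ 39 * N ^ 64) := by gcongr
    _ = (2 ^ 234 * C ^ 39) * (N ^ (32 / 13 + ε)) ^ 26 := by
      rw [mul_pow, ← Real.rpow_mul_natCast hN0.le, ← Real.rpow_mul_natCast hN0.le,
        ← Real.rpow_natCast N 64, mul_assoc, ← Real.rpow_add hN0, mul_assoc]
      congr 3
      push_cast; ring
    _ ≤ (2 ^ 234 * C ^ 39) ^ 26 * (N ^ (32 / 13 + ε)) ^ 26 := by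
      gcongr
      exact le_self_pow₀ h3 (by norm_num)
    _ = _ := (mul_pow _ _ _).symm

theorem setMomentBound (k : ℕ) : SetMomentBound k (2 * k - 2 + 2 * (1 / 2) ^ k) := by
  intro ε hε
  simp only [integral_norm_pow_eq_sumEnergy]
  induction k generalizing ε with
  | zero =>
    refine ⟨1, by norm_num, fun A _ hA1 => ?_⟩
    have : (1 : ℝ) ≤ A.card := by exact_mod_cast hA1
    have h2 : (1 : ℝ) ≤ (A.card : ℝ) ^ (2 * ((0 : ℕ) : ℝ) - 2 + 2 * (1 / 2) ^ 0 + ε) :=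
      Real.one_le_rpow this (by simp; exact hε.le)
    simpa [sumEnergy, iteratedSumset, sumCount] using h2
  | succ k ih =>
    obtain ⟨C, hC, ihC⟩ := ih ε hε
    -- The logarithmic factors cost (4k + 2)δ = ε in the exponent and the induction hypothesis
    -- another ε; the squared target allows 2ε.
    set δ := ε / (2 * (2 * k + 1)) with hδ
    have hδ0 : 0 < δ := by positivity
    obtain ⟨D, hD, hL⟩ := exists_dyadicLen_le hδ0
    -- Adding 1 ensures that the constant is at most the square of the chosen one.
    refine ⟨2 ^ 16 * D ^ 6 * C + 1, by positivity, fun A hA hA1 => ?_⟩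
    have h1 : (sumEnergy A (k + 1) : ℝ) ^ 2 ≤ 2 ^ 16 * (dyadicLen (A.card ^ k) : ℝ) ^ 4 *
        (dyadicLen A.card : ℝ) ^ 2 * (A.card : ℝ) ^ (2 * (k + 1)) * sumEnergy A k := by
      exact_mod_cast sq_sumEnergy_succ_le hA k
    have h2 := hL _ hA1
    have h3 := hL (A.card ^ k) (Nat.one_le_pow _ _ hA1)
    have h4 := ihC A hA hA1
    push_cast at h3
    set N : ℝ := (A.card : ℝ) with hN
    have hN0 : 0 < N := by rw [hN]; exact_mod_cast hA1
    refine (pow_le_pow_iff_left₀ (by positivity) (by positivity) (n := 2) (by norm_num)).1 ?_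
    set e : ℝ := 2 * k - 2 + 2 * (1 / 2) ^ k with he
    calc (sumEnergy A (k + 1) : ℝ) ^ 2 ≤ _ := h1
      _ ≤ 2 ^ 16 * (D * (N ^ k) ^ δ) ^ 4 * (D * N ^ δ) ^ 2 * N ^ (2 * (k + 1)) *
          (C * N ^ (e + ε)) := by gcongr
      _ = (2 ^ 16 * D ^ 6 * C) * ((N ^ k) ^ δ) ^ 4 * (N ^ δ) ^ 2 * N ^ (2 * (k + 1)) *
          N ^ (e + ε) := by ring
      _ = (2 ^ 16 * D ^ 6 * C) * (N ^ (2 * ((k + 1 : ℕ) : ℝ) - 2 +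
          2 * (1 / 2) ^ (k + 1) + ε)) ^ 2 := by
        rw [← Real.rpow_natCast N k, ← Real.rpow_mul hN0.le, ← Real.rpow_mul_natCast hN0.le,
          ← Real.rpow_mul_natCast hN0.le, ← Real.rpow_mul_natCast hN0.le,
          ← Real.rpow_natCast N (2 * (k + 1)), mul_assoc, mul_assoc, mul_assoc,
          ← Real.rpow_add hN0, ← Real.rpow_add hN0, ← Real.rpow_add hN0]
        congr 2
        have : δ * (2 * (2 * k + 1)) = ε := by rw [hδ]; field_simp
        rw [he, pow_succ]
        push_cast
        linear_combination this
      _ ≤ (2 ^ 16 * D ^ 6 * C + 1) ^ 2 * (N ^ (2 * ((k + 1 : ℕ) : ℝ) - 2 +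
          2 * (1 / 2) ^ (k + 1) + ε)) ^ 2 := by
        gcongr
        have : 0 ≤ 2 ^ 16 * D ^ 6 * C := by positivity
        nlinarith
      _ = _ := by rw [mul_pow]

/-! ### Blocks of strictly convex sequences -/

section ConvexSequence

variable {g : ℕ → ℤ}

lemma lt_of_diff_pos (hg : StrictMono fun n => g (n + 1) - g n) {m n : ℕ} (hmn : m < n)
    (hm : 0 < g (m + 1) - g m) : g m < g n := by
  induction n, hmn using Nat.le_induction with
  | base => simp only [Nat.succ_eq_add_one]; omega
  | succ n hn ih =>
    have := hg (show m < n from hn)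
    simp only at this
    omega

/-- Only the step leaving the later index may vanish; all earlier steps are strictly negative. Hence
a flat bottom of the sequence does not spoil strict decrease. -/
lemma lt_of_diff_nonpos (hg : StrictMono fun n => g (n + 1) - g n) (d m : ℕ)
    (hm : g (m + d + 1 + 1) - g (m + d + 1) ≤ 0) : g (m + d + 1) < g m := by
  induction d with
  | zero =>
    have := hg (Nat.lt_add_one m)
    simp only [add_zero] at this hm ⊢
    omega
  | succ d ih =>
    have := hg (Nat.lt_add_one (m + d + 1))
    simp only [← add_assoc] at this hm ⊢
    have := ih (by omega)
    omega

lemma diff_lt_diff (hg : StrictMono fun n => g (n + 1) - g n) {m m' : ℕ} (hm : m < m') (h : ℕ) :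
    g (m + (h + 1)) - g m < g (m' + (h + 1)) - g m' := by
  induction h with
  | zero => exact hg hm
  | succ h ih =>
    have := hg (show m + (h + 1) < m' + (h + 1) by omega)
    simp only [← add_assoc] at this ih ⊢
    omega

/-- On a run of consecutive indices, the number of values in [g(m), g(n)) is n - m, so equal counts
mean equal index shifts, and `diff_lt_diff` separates the starting points. -/
lemma hasDistinctGaps_of_strictMonoOn (hg : StrictMono fun n => g (n + 1) - g n) {J : Finset ℕ}
    (hJ : (J : Set ℕ).OrdConnected) (hmono : StrictMonoOn g J) : HasDistinctGaps (J.image g) := by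
  have hcard : ∀ m ∈ J, ∀ n ∈ J, (J.image g ∩ Finset.Ico (g m) (g n)).card = n - m := by
    intro m hm n hn
    have : J.image g ∩ Finset.Ico (g m) (g n) = (Finset.Ico m n).image g := by
      ext y
      simp only [Finset.mem_inter, Finset.mem_image, Finset.mem_Ico]
      constructor
      · rintro ⟨⟨l, hl, rfl⟩, h1, h2⟩
        exact ⟨l, ⟨(hmono.le_iff_le hm hl).1 h1, (hmono.lt_iff_lt hl hn).1 h2⟩, rfl⟩
      · rintro ⟨l, ⟨h1, h2⟩, rfl⟩
        have hl : l ∈ J := hJ.out hm hn ⟨h1, h2.le⟩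
        exact ⟨⟨l, hl, rfl⟩, (hmono.le_iff_le hm hl).2 h1, (hmono.lt_iff_lt hl hn).2 h2⟩
    rw [this, Finset.card_image_of_injOn, Nat.card_Ico]
    exact hmono.injOn.mono fun l hl => by
      rw [Finset.coe_Ico, Set.mem_Ico] at hl
      exact hJ.out hm hn ⟨hl.1, hl.2.le⟩
  simp only [HasDistinctGaps, Finset.forall_mem_image]
  intro m hm n hn p hp q hq hmn hpq hdiff hc
  rw [hcard m hm n hn, hcard p hp q hq] at hc
  rw [hmono.lt_iff_lt hm hn] at hmn
  rw [hmono.lt_iff_lt hp hq] at hpq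
  obtain ⟨h, rfl⟩ : ∃ h, n = m + (h + 1) := ⟨n - m - 1, by omega⟩
  obtain rfl : q = p + (h + 1) := by omega
  rcases lt_trichotomy m p with hlt | rfl | hlt
  · have := diff_lt_diff hg hlt h; omega
  · rfl
  · have := diff_lt_diff hg hlt h; omega

lemma hasDistinctGaps_of_strictAntiOn (hg : StrictMono fun n => g (n + 1) - g n) {J : Finset ℕ}
    (hJ : (J : Set ℕ).OrdConnected) (hanti : StrictAntiOn g J) : HasDistinctGaps (J.image g) := by
  have hcard : ∀ m ∈ J, ∀ n ∈ J, (J.image g ∩ Finset.Ico (g m) (g n)).card = m - n := by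
    intro m hm n hn
    have : J.image g ∩ Finset.Ico (g m) (g n) = (Finset.Ioc n m).image g := by
      ext y
      simp only [Finset.mem_inter, Finset.mem_image, Finset.mem_Ico, Finset.mem_Ioc]
      constructor
      · rintro ⟨⟨l, hl, rfl⟩, h1, h2⟩
        exact ⟨l, ⟨(hanti.lt_iff_gt hl hn).1 h2, (hanti.le_iff_ge hm hl).1 h1⟩, rfl⟩
      · rintro ⟨l, ⟨h1, h2⟩, rfl⟩
        have hl : l ∈ J := hJ.out hn hm ⟨h1.le, h2⟩
        exact ⟨⟨l, hl, rfl⟩, (hanti.le_iff_ge hm hl).2 h2, (hanti.lt_iff_gt hl hn).2 h1⟩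
    rw [this, Finset.card_image_of_injOn, Nat.card_Ioc]
    exact hanti.injOn.mono fun l hl => by
      rw [Finset.coe_Ioc, Set.mem_Ioc] at hl
      exact hJ.out hn hm ⟨hl.1.le, hl.2⟩
  simp only [HasDistinctGaps, Finset.forall_mem_image]
  intro m hm n hn p hp q hq hmn hpq hdiff hc
  rw [hcard m hm n hn, hcard p hp q hq] at hc
  rw [hanti.lt_iff_gt hm hn] at hmn
  rw [hanti.lt_iff_gt hp hq] at hpq
  obtain ⟨h, rfl⟩ : ∃ h, m = n + (h + 1) := ⟨m - n - 1, by omega⟩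
  obtain rfl : p = q + (h + 1) := by omega
  rcases lt_trichotomy n q with hlt | rfl | hlt
  · have := diff_lt_diff hg hlt h; omega
  · rfl
  · have := diff_lt_diff hg hlt h; omega

lemma integral_norm_pow_le_of_image {k : ℕ} {E ε C : ℝ} (hk : k ≠ 0) (hE : 0 ≤ E + ε) (hC0 : 0 ≤ C)
    (hC : ∀ A : Finset ℤ, HasDistinctGaps A → 1 ≤ A.card →
      ∫ x in (0 : ℝ)..1, ‖∑ a ∈ A, unitExp x a‖ ^ (2 * k) ≤ C * (A.card : ℝ) ^ (E + ε))
    {J : Finset ℕ} {N : ℕ} (hJN : J.card ≤ N) (hinj : Set.InjOn g J)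
    (hJ : HasDistinctGaps (J.image g)) :
    ∫ x in (0 : ℝ)..1, ‖∑ n ∈ J, unitExp x (g n)‖ ^ (2 * k) ≤ C * (N : ℝ) ^ (E + ε) := by
  rcases J.eq_empty_or_nonempty with rfl | hne
  · simp only [Finset.sum_empty, norm_zero]
    rw [zero_pow (by omega)]
    simp; positivity
  · have h1 := hC _ hJ (Finset.card_pos.2 (hne.image g))
    simp only [Finset.sum_image hinj] at h1
    rw [Finset.card_image_of_injOn hinj] at h1
    refine h1.trans ?_
    gcongr

/-- The `2k`-th moments of the exponential sums over blocks of length `N` of a strictly convex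
sequence are at most `N ^ (E + ε)`. -/
theorem exists_integral_block_le (hg : StrictMono fun n => g (n + 1) - g n) {k : ℕ} {E : ℝ}
    (hk : k ≠ 0) (hE : 0 ≤ E) (hM : SetMomentBound k E) {ε : ℝ} (hε : 0 < ε) :
    ∃ C : ℝ, 0 ≤ C ∧ ∀ a N : ℕ,
      ∫ x in (0 : ℝ)..1, ‖∑ n ∈ Finset.Ico a (a + N), unitExp x (g n)‖ ^ (2 * k) ≤
        C * (N : ℝ) ^ (E + ε) := by
  obtain ⟨C, hC0, hC⟩ := hM ε hε
  -- The block is split by the sign of its steps, and the constant comes from (u + v)^p ≤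
  -- 2^{p-1}(u^p + v^p) with p = 2k.
  refine ⟨2 ^ (2 * k - 1) * (C + C), by positivity, fun a N => ?_⟩
  set J₁ := (Finset.Ico a (a + N)).filter fun n => 0 < g (n + 1) - g n with hJ₁
  set J₂ := (Finset.Ico a (a + N)).filter fun n => ¬ 0 < g (n + 1) - g n with hJ₂
  have hc : ∀ J : Finset ℕ, J ⊆ Finset.Ico a (a + N) → J.card ≤ N := fun J hJ => by
    simpa using Finset.card_le_card hJ
  have hm₁ : StrictMonoOn g J₁ := fun m hm n _ hmn =>
    lt_of_diff_pos hg hmn (Finset.mem_filter.1 hm).2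
  have hm₂ : StrictAntiOn g J₂ := by
    intro m _ n hn hmn
    obtain ⟨d, rfl⟩ : ∃ d, n = m + d + 1 := ⟨n - m - 1, by omega⟩
    exact lt_of_diff_nonpos hg d m (not_lt.1 (Finset.mem_filter.1 hn).2)
  have ho₁ : (J₁ : Set ℕ).OrdConnected := by
    refine ⟨fun m hm n hn l hl => ?_⟩
    simp only [hJ₁, Finset.coe_filter, Finset.mem_Ico, Set.mem_ofPred_eq] at hm hn ⊢
    have : g (m + 1) - g m ≤ g (l + 1) - g l := hg.monotone hl.1
    exact ⟨⟨hm.1.1.trans hl.1, hl.2.trans_lt hn.1.2⟩, by omega⟩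
  have ho₂ : (J₂ : Set ℕ).OrdConnected := by
    refine ⟨fun m hm n hn l hl => ?_⟩
    simp only [hJ₂, Finset.coe_filter, Finset.mem_Ico, Set.mem_ofPred_eq] at hm hn ⊢
    have : g (l + 1) - g l ≤ g (n + 1) - g n := hg.monotone hl.2
    exact ⟨⟨hm.1.1.trans hl.1, hl.2.trans_lt hn.1.2⟩, by omega⟩
  have h1 := integral_norm_pow_le_of_image hk (by positivity) hC0 hC
    (hc J₁ (Finset.filter_subset _ _)) hm₁.injOn (hasDistinctGaps_of_strictMonoOn hg ho₁ hm₁)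
  have h2 := integral_norm_pow_le_of_image hk (by positivity) hC0 hC
    (hc J₂ (Finset.filter_subset _ _)) hm₂.injOn (hasDistinctGaps_of_strictAntiOn hg ho₂ hm₂)
  have hcont : ∀ J : Finset ℕ, Continuous fun x => ‖∑ n ∈ J, unitExp x (g n)‖ ^ (2 * k) := fun J =>
    (continuous_finsetSum _ fun n _ => continuous_unitExp _).norm.pow _
  calc ∫ x in (0 : ℝ)..1, ‖∑ n ∈ Finset.Ico a (a + N), unitExp x (g n)‖ ^ (2 * k)
      ≤ ∫ x in (0 : ℝ)..1, 2 ^ (2 * k - 1) * (‖∑ n ∈ J₁, unitExp x (g n)‖ ^ (2 * k) +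
          ‖∑ n ∈ J₂, unitExp x (g n)‖ ^ (2 * k)) := by
        refine intervalIntegral.integral_mono_on zero_le_one
          ((hcont _).intervalIntegrable _ _)
          ((((hcont _).add (hcont _)).const_mul _).intervalIntegrable _ _) fun x _ => ?_
        rw [← Finset.sum_filter_add_sum_filter_not (Finset.Ico a (a + N))
          (fun n => 0 < g (n + 1) - g n)]
        refine (pow_le_pow_left₀ (norm_nonneg _) (norm_add_le _ _) _).trans ?_
        exact add_pow_le (norm_nonneg _) (norm_nonneg _) _
    _ = 2 ^ (2 * k - 1) * ((∫ x in (0 : ℝ)..1, ‖∑ n ∈ J₁, unitExp x (g n)‖ ^ (2 * k)) +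
          ∫ x in (0 : ℝ)..1, ‖∑ n ∈ J₂, unitExp x (g n)‖ ^ (2 * k)) := by
        rw [intervalIntegral.integral_const_mul, intervalIntegral.integral_add
          ((hcont _).intervalIntegrable _ _) ((hcont _).intervalIntegrable _ _)]
    _ ≤ 2 ^ (2 * k - 1) * (C * (N : ℝ) ^ (E + ε) + C * (N : ℝ) ^ (E + ε)) := by gcongr
    _ = _ := by ring

end ConvexSequence

/-! ### Coverings of the set of large values -/

/-- A set which is contained in the upper limit of finite families of sets of geometrically
decaying total size has small Hausdorff dimension. -/
lemma dimH_le_of_frequently_mem {F : Set ℝ} {s θ K ρ : ℝ} (hs : 0 < s) (hθ0 : 0 ≤ θ) (hθ1 : θ < 1)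
    (hρ0 : 0 ≤ ρ) (hρ1 : ρ < 1) (hK : 0 ≤ K) {B : ℕ → Finset ℕ} {t : ℕ → ℕ → Set ℝ} {δ : ℕ → ℝ}
    (m₀ : ℕ) (hδ0 : ∀ m, 0 ≤ δ m) (hδ : ∀ m, δ m ≤ θ ^ m)
    (hdiam : ∀ m, ∀ i ∈ B m, Metric.ediam (t m i) ≤ ENNReal.ofReal (δ m))
    (hcard : ∀ m, m₀ ≤ m → (B m).card * δ m ^ s ≤ K * ρ ^ m)
    (hF : ∀ x ∈ F, ∃ᶠ m in atTop, ∃ i ∈ B m, x ∈ t m i) : dimH F ≤ ENNReal.ofReal s := by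
  refine dimH_le_of_hausdorffMeasure_ne_top (d := s.toNNReal) ?_
  rw [Real.coe_toNNReal s hs.le]
  have hr : Tendsto (fun n : ℕ => ENNReal.ofReal (θ ^ n)) atTop (nhds 0) := by
    rw [← ENNReal.ofReal_zero]
    exact ENNReal.tendsto_ofReal (tendsto_pow_atTop_nhds_zero_of_lt_one hθ0 hθ1)
  have hsum : Summable fun m : ℕ => K * ρ ^ m :=
    (summable_geometric_of_lt_one hρ0 hρ1).mul_left K
  refine ne_top_of_le_ne_top hsum.tsum_ofReal_ne_top ?_
  refine (Measure.hausdorffMeasure_le_liminf_tsum (ι := fun n => Σ m : ℕ, {i // i ∈ B (m + n)})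
    s F _ hr (fun n p => t (p.1 + n) p.2.1) ?_ ?_).trans ?_
  · refine Eventually.of_forall fun n p => (hdiam _ _ p.2.2).trans (ENNReal.ofReal_le_ofReal ?_)
    exact (hδ _).trans (pow_le_pow_of_le_one hθ0 hθ1.le (Nat.le_add_left _ _))
  · refine Eventually.of_forall fun n x hx => ?_
    obtain ⟨m, hm, i, hi, hxi⟩ := frequently_atTop.1 (hF x hx) n
    obtain ⟨l, rfl⟩ := Nat.exists_eq_add_of_le' hm
    exact Set.mem_iUnion.2 ⟨⟨l, i, hi⟩, hxi⟩
  · refine liminf_le_of_frequently_le' (Eventually.frequently ?_)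
    filter_upwards [eventually_ge_atTop m₀] with n hn
    rw [ENNReal.tsum_sigma']
    refine ENNReal.tsum_le_tsum fun m => ?_
    rw [tsum_fintype]
    refine (Finset.sum_le_card_nsmul _ _ (ENNReal.ofReal (δ (m + n) ^ s)) fun i _ => ?_).trans ?_
    · rw [← ENNReal.ofReal_rpow_of_nonneg (hδ0 _) hs.le]
      exact ENNReal.rpow_le_rpow (hdiam _ _ i.2) hs.le
    · rw [Finset.card_univ, Fintype.card_coe, ← ENNReal.ofReal_nsmul, nsmul_eq_mul]
      refine ENNReal.ofReal_le_ofReal ((hcard _ (by omega)).trans ?_)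
      exact mul_le_mul_of_nonneg_left (pow_le_pow_of_le_one hρ0 hρ1.le (Nat.le_add_right _ _)) hK

/-- Binary expansion: [0, N) is a disjoint union of dyadic blocks, at most one per scale. The
induction keeps the left half whole and descends into the right half. -/
lemma norm_sum_range_le_of_dyadic {u : ℕ → ℂ} {V : ℝ} {M : ℕ}
    (h : ∀ j ≤ M, ∀ i < 2 ^ (M - j),
      ‖∑ n ∈ Finset.Ico (i * 2 ^ j) (i * 2 ^ j + 2 ^ j), u n‖ ≤ V) {N : ℕ} (hN : N ≤ 2 ^ M) :
    ‖∑ n ∈ Finset.range N, u n‖ ≤ (M + 1) * V := by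
  have hV : 0 ≤ V := (norm_nonneg _).trans (h 0 (Nat.zero_le _) 0 (by positivity))
  have key : ∀ m ≤ M, ∀ i < 2 ^ (M - m), ∀ N ≤ 2 ^ m,
      ‖∑ n ∈ Finset.Ico (i * 2 ^ m) (i * 2 ^ m + N), u n‖ ≤ (m + 1) * V := by
    intro m
    induction m with
    | zero =>
      intro hm i hi N hN
      rcases Nat.le_one_iff_eq_zero_or_eq_one.1 hN with rfl | rfl
      · simpa using hV
      · simpa using h 0 hm i hi
    | succ m ih =>
      intro hm i hi N hN
      have hpow : 2 ^ (M - m) = 2 * 2 ^ (M - (m + 1)) := by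
        rw [← pow_succ']; congr 1; omega
      rw [show i * 2 ^ (m + 1) = 2 * i * 2 ^ m by ring]
      push_cast
      rcases le_total N (2 ^ m) with h1 | h1
      · have := ih (by omega) (2 * i) (by omega) N h1
        linarith
      · obtain ⟨N', rfl⟩ := Nat.exists_eq_add_of_le h1
        have h2 := ih (by omega) (2 * i + 1) (by omega) N' (by rw [pow_succ] at hN; omega)
        have h3 := h m (by omega) (2 * i) (by omega)
        rw [show (2 * i + 1) * 2 ^ m = 2 * i * 2 ^ m + 2 ^ m by ring] at h2
        rw [← add_assoc, ← Finset.sum_Ico_consecutive _ (Nat.le_add_right (2 * i * 2 ^ m) (2 ^ m))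
          (Nat.le_add_right _ _)]
        refine (norm_add_le _ _).trans ?_
        linarith
  simpa using key M le_rfl 0 (by positivity) N hN

lemma norm_unitExp_sub_le (x y : ℝ) (n : ℤ) :
    ‖unitExp x n - unitExp y n‖ ≤ 2 * Real.pi * |(n : ℝ)| * |x - y| := by
  have h1 : unitExp x n - unitExp y n =
      unitExp y n * (Complex.exp (Complex.I * ((2 * Real.pi * n * (x - y) : ℝ) : ℂ)) - 1) := by
    rw [mul_sub, mul_one, unitExp, unitExp, ← Complex.exp_add]
    congr 2
    push_cast; ring
  rw [h1, norm_mul, norm_unitExp, one_mul]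
  refine Real.norm_exp_I_mul_ofReal_sub_one_le.trans_eq ?_
  rw [Real.norm_eq_abs, abs_mul, abs_mul, abs_of_pos Real.two_pi_pos]

lemma norm_sum_unitExp_sub_le (g : ℕ → ℤ) (J : Finset ℕ) (x y : ℝ) :
    ‖∑ n ∈ J, unitExp x (g n) - ∑ n ∈ J, unitExp y (g n)‖ ≤
      2 * Real.pi * (∑ n ∈ J, |(g n : ℝ)|) * |x - y| := by
  rw [← Finset.sum_sub_distrib, Finset.mul_sum, Finset.sum_mul]
  exact (norm_sum_le _ _).trans (Finset.sum_le_sum fun n _ => norm_unitExp_sub_le x y (g n))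

open Classical in
/-- The indices of the intervals of length `1 / Q` which contain a point where `φ` is large. -/
noncomputable def largeIntervals (φ : ℝ → ℂ) (V : ℝ) (Q : ℕ) : Finset ℕ :=
  (Finset.range Q).filter fun i =>
    ∃ x ∈ Set.Icc ((i : ℝ) / Q) (((i : ℝ) + 1) / Q), V ≤ ‖φ x‖

lemma mem_largeIntervals {φ : ℝ → ℂ} {V : ℝ} {Q i : ℕ} : i ∈ largeIntervals φ V Q ↔
    i < Q ∧ ∃ x ∈ Set.Icc ((i : ℝ) / Q) (((i : ℝ) + 1) / Q), V ≤ ‖φ x‖ := by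
  simp only [largeIntervals, Finset.mem_filter, Finset.mem_range]

/-- Over a length 1/Q the function changes by at most V/2, so it stays at least V/2 on every counted
interval, and Chebyshev's inequality applies. -/
lemma card_largeIntervals_le {φ : ℝ → ℂ} (hφ : Continuous φ) {Λ V : ℝ} (hV : 0 < V)
    (hΛ0 : 0 ≤ Λ) (hLip : ∀ x y, ‖φ x - φ y‖ ≤ Λ * |x - y|) {Q : ℕ} (hQ : 0 < Q)
    (hΛ : Λ ≤ Q * (V / 2)) (p : ℕ) :
    ((largeIntervals φ V Q).card : ℝ) ≤
      Q * (2 / V) ^ p * ∫ x in (0 : ℝ)..1, ‖φ x‖ ^ p := by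
  have hQ0 : (0 : ℝ) < Q := by exact_mod_cast hQ
  have hcont : Continuous fun x => ‖φ x‖ ^ p := hφ.norm.pow _
  have hint : ∀ a b : ℝ, IntervalIntegrable (fun x => ‖φ x‖ ^ p) volume a b :=
    fun a b => hcont.intervalIntegrable a b
  have hlen : ∀ i : ℕ, ((i : ℝ) + 1) / Q - i / Q = 1 / Q := fun i => by ring
  have hle : ∀ i : ℕ, (i : ℝ) / Q ≤ ((i : ℝ) + 1) / Q := fun i => by gcongr; simp
  have h1 : ∀ i ∈ largeIntervals φ V Q, (V / 2) ^ p * (1 / Q) ≤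
      ∫ x in ((i : ℝ) / Q)..(((i : ℝ) + 1) / Q), ‖φ x‖ ^ p := by
    intro i hi
    obtain ⟨-, x, hx, hVx⟩ := mem_largeIntervals.1 hi
    have h2 : ∀ y ∈ Set.Icc ((i : ℝ) / Q) (((i : ℝ) + 1) / Q), (V / 2) ^ p ≤ ‖φ y‖ ^ p := by
      intro y hy
      have hxy : |x - y| ≤ 1 / Q := by
        rw [abs_le, ← hlen i]
        constructor <;> linarith [hx.1, hx.2, hy.1, hy.2]
      have h3 : Λ * |x - y| ≤ V / 2 := by
        refine (mul_le_mul_of_nonneg_left hxy hΛ0).trans ?_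
        rw [mul_one_div, div_le_iff₀ hQ0]
        linarith
      have h4 := hLip x y
      have h5 := norm_sub_norm_le (φ x) (φ y)
      gcongr
      linarith
    have h3 := intervalIntegral.integral_mono_on (hle i)
      (_root_.intervalIntegrable_const (c := (V / 2) ^ p) (μ := volume)) (hint _ _) h2
    rw [intervalIntegral.integral_const, hlen, smul_eq_mul] at h3
    linarith
  have h2 : ∑ i ∈ Finset.range Q, ∫ x in ((i : ℝ) / Q)..(((i : ℝ) + 1) / Q), ‖φ x‖ ^ p =
      ∫ x in (0 : ℝ)..1, ‖φ x‖ ^ p := by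
    have := intervalIntegral.sum_integral_adjacent_intervals (f := fun x => ‖φ x‖ ^ p)
      (μ := volume) (a := fun i : ℕ => (i : ℝ) / Q) (n := Q) (fun i _ => hint _ _)
    simp only [Nat.cast_add, Nat.cast_one, CharP.cast_eq_zero, zero_div, div_self hQ0.ne'] at this
    exact this
  have h3 : ((largeIntervals φ V Q).card : ℝ) * ((V / 2) ^ p * (1 / Q)) ≤
      ∫ x in (0 : ℝ)..1, ‖φ x‖ ^ p := by
    rw [← nsmul_eq_mul, ← h2]
    refine (Finset.card_nsmul_le_sum _ _ _ h1).trans ?_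
    refine Finset.sum_le_sum_of_subset_of_nonneg (fun i hi => Finset.mem_range.2
      (mem_largeIntervals.1 hi).1) fun i _ _ => ?_
    exact intervalIntegral.integral_nonneg (hle i) fun x _ => by positivity
  calc ((largeIntervals φ V Q).card : ℝ)
      = Q * (2 / V) ^ p * (((largeIntervals φ V Q).card : ℝ) * ((V / 2) ^ p * (1 / Q))) := by
        have : (2 / V) ^ p * (V / 2) ^ p = 1 := by
          rw [← mul_pow, div_mul_div_cancel₀ hV.ne', div_self two_ne_zero, one_pow]
        field_simp
        rw [mul_assoc, this, mul_one]
    _ ≤ _ := by gcongr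

lemma exists_mem_Icc_div {x : ℝ} (hx : x ∈ Set.Icc (0 : ℝ) 1) {Q : ℕ} (hQ : 0 < Q) :
    ∃ i < Q, x ∈ Set.Icc ((i : ℝ) / Q) (((i : ℝ) + 1) / Q) := by
  have hQ0 : (0 : ℝ) < Q := by exact_mod_cast hQ
  rcases hx.2.eq_or_lt with rfl | h
  · refine ⟨Q - 1, by omega, ?_⟩
    rw [Nat.cast_sub hQ, Set.mem_Icc, div_le_iff₀ hQ0, le_div_iff₀ hQ0]
    simp
  · refine ⟨⌊x * Q⌋₊, ?_, ?_⟩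
    · rw [Nat.floor_lt (by have := hx.1; positivity)]
      nlinarith
    · rw [Set.mem_Icc, div_le_iff₀ hQ0, le_div_iff₀ hQ0]
      exact ⟨Nat.floor_le (by have := hx.1; positivity), (Nat.lt_floor_add_one _).le⟩

/-- The points of `[0, 1]` where one of the first `2 ^ m` partial sums is large are covered by
few intervals of length `1 / Q`. -/
lemma exists_cover_of_moment {g : ℕ → ℤ} {p : ℕ} {e C : ℝ} (he : 1 ≤ e) (hC0 : 0 ≤ C)
    (hC : ∀ a N : ℕ, ∫ x in (0 : ℝ)..1, ‖∑ n ∈ Finset.Ico a (a + N), unitExp x (g n)‖ ^ p ≤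
      C * (N : ℝ) ^ e) {V : ℝ} (hV : 0 < V) {m Q : ℕ} (hQ : 0 < Q)
    (hVQ : 2 * Real.pi * (∑ n ∈ Finset.range (2 ^ m), |(g n : ℝ)|) ≤ Q * (V / 2)) :
    ∃ B : Finset ℕ, (B.card : ℝ) ≤ (m + 1) * (Q * (2 / V) ^ p * (C * ((2 : ℝ) ^ m) ^ e)) ∧
      ∀ x ∈ Set.Icc (0 : ℝ) 1, ∀ N ≤ 2 ^ m,
        (m + 1) * V < ‖∑ n ∈ Finset.range N, unitExp x (g n)‖ →
        ∃ i ∈ B, x ∈ Set.Icc ((i : ℝ) / Q) (((i : ℝ) + 1) / Q) := by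
  set φ : ℕ → ℕ → ℝ → ℂ := fun j i x =>
    ∑ n ∈ Finset.Ico (i * 2 ^ j) (i * 2 ^ j + 2 ^ j), unitExp x (g n) with hφ
  refine ⟨(Finset.range (m + 1)).biUnion fun j => (Finset.range (2 ^ (m - j))).biUnion fun i =>
    largeIntervals (φ j i) V Q, ?_, ?_⟩
  · have h1 : ∀ j ∈ Finset.range (m + 1), ∀ i ∈ Finset.range (2 ^ (m - j)),
        ((largeIntervals (φ j i) V Q).card : ℝ) ≤
          Q * (2 / V) ^ p * (C * ((2 : ℝ) ^ j) ^ e) := by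
      intro j hj i hi
      rw [Finset.mem_range] at hj hi
      have hsub : Finset.Ico (i * 2 ^ j) (i * 2 ^ j + 2 ^ j) ⊆ Finset.range (2 ^ m) := by
        intro n hn
        rw [Finset.mem_Ico] at hn
        rw [Finset.mem_range]
        calc n < (i + 1) * 2 ^ j := by linarith [hn.2]
          _ ≤ 2 ^ (m - j) * 2 ^ j := Nat.mul_le_mul_right _ hi
          _ = 2 ^ m := by rw [← pow_add]; congr 1; omega
      refine (card_largeIntervals_le (Λ := 2 * Real.pi *
        ∑ n ∈ Finset.Ico (i * 2 ^ j) (i * 2 ^ j + 2 ^ j), |(g n : ℝ)|) ?_ hV ?_ ?_ hQ ?_ p).trans ?_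
      · exact continuous_finsetSum _ fun n _ => continuous_unitExp _
      · exact mul_nonneg Real.two_pi_pos.le (Finset.sum_nonneg fun _ _ => abs_nonneg _)
      · exact norm_sum_unitExp_sub_le g _
      · refine (mul_le_mul_of_nonneg_left ?_ Real.two_pi_pos.le).trans hVQ
        exact Finset.sum_le_sum_of_subset_of_nonneg hsub fun _ _ _ => abs_nonneg _
      · have := hC (i * 2 ^ j) (2 ^ j)
        push_cast at this
        gcongr
    -- Because e ≥ 1, the 2^{m-j} blocks of length 2^j together cost no more than one block of
    -- length 2^m.
    have h2 : ∀ j ∈ Finset.range (m + 1), ((2 ^ (m - j) : ℕ) : ℝ) * ((2 : ℝ) ^ j) ^ e ≤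
        ((2 : ℝ) ^ m) ^ e := by
      intro j hj
      rw [Finset.mem_range] at hj
      have h3 : (2 : ℝ) ^ m = 2 ^ (m - j) * 2 ^ j := by rw [← pow_add]; congr 1; omega
      rw [h3, Real.mul_rpow (by positivity) (by positivity)]
      push_cast
      gcongr
      exact Real.self_le_rpow_of_one_le (one_le_pow₀ one_le_two) he
    have h3 : ∀ j ∈ Finset.range (m + 1), (((Finset.range (2 ^ (m - j))).biUnion fun i =>
        largeIntervals (φ j i) V Q).card : ℝ) ≤ Q * (2 / V) ^ p * (C * ((2 : ℝ) ^ m) ^ e) := by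
      intro j hj
      calc (((Finset.range (2 ^ (m - j))).biUnion fun i =>
            largeIntervals (φ j i) V Q).card : ℝ)
          ≤ ∑ i ∈ Finset.range (2 ^ (m - j)), ((largeIntervals (φ j i) V Q).card : ℝ) := by
            exact_mod_cast Finset.card_biUnion_le
        _ ≤ (2 ^ (m - j) : ℕ) * (Q * (2 / V) ^ p * (C * ((2 : ℝ) ^ j) ^ e)) := by
            refine (Finset.sum_le_card_nsmul _ _ _ (h1 j hj)).trans_eq ?_
            rw [Finset.card_range, nsmul_eq_mul]
        _ = Q * (2 / V) ^ p * (C * ((2 ^ (m - j) : ℕ) * ((2 : ℝ) ^ j) ^ e)) := by ring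
        _ ≤ _ := by
            have := h2 j hj
            gcongr
    calc _ ≤ ∑ j ∈ Finset.range (m + 1), (((Finset.range (2 ^ (m - j))).biUnion fun i =>
            largeIntervals (φ j i) V Q).card : ℝ) := by
          exact_mod_cast Finset.card_biUnion_le
      _ ≤ _ := by
          refine (Finset.sum_le_card_nsmul _ _ _ h3).trans_eq ?_
          rw [Finset.card_range, nsmul_eq_mul]
          push_cast; ring
  · intro x hx N hN hlarge
    obtain ⟨l, hl, hxl⟩ := exists_mem_Icc_div hx hQ
    refine ⟨l, ?_, hxl⟩
    by_contra hnot
    refine absurd (norm_sum_range_le_of_dyadic (V := V) (fun j hj i hi => ?_) hN) (not_le.2 hlarge)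
    by_contra hV'
    refine hnot (Finset.mem_biUnion.2 ⟨j, Finset.mem_range.2 (by omega), Finset.mem_biUnion.2
      ⟨i, Finset.mem_range.2 hi, mem_largeIntervals.2 ⟨hl, x, hxl, ?_⟩⟩⟩)
    exact (not_le.1 hV').le

/-! ### From moment exponents to dimension bounds -/

lemma eventually_two_mul_add_one_lt_pow {b : ℝ} (hb : 1 < b) :
    ∀ᶠ m : ℕ in atTop, 2 * ((m : ℝ) + 1) < b ^ m := by
  have h := (tendsto_pow_const_div_const_pow_of_one_lt 1 hb).eventually_lt_const
    (show (0 : ℝ) < 1 / 4 by norm_num)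
  filter_upwards [h, eventually_ge_atTop 1] with m hm hm1
  have hm1' : (1 : ℝ) ≤ m := by exact_mod_cast hm1
  rw [pow_one, div_lt_iff₀ (by positivity)] at hm
  linarith

/-- A moment bound for the exponential sums over the blocks of a sequence yields a bound for the
Hausdorff dimension of the set of points with large partial sums. -/
theorem dimH_le_of_moment {g : ℕ → ℤ} {τ α : ℝ} (hα1 : α < 1) (hτ : 0 < τ) (hα0 : 0 < α)
    {G : ℝ} {N₀ : ℕ}
    (hG : ∀ N : ℕ, N₀ ≤ N → ∑ n ∈ Finset.range N, |(g n : ℝ)| ≤ G * (N : ℝ) ^ (τ + 1))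
    {k : ℕ} {E : ℝ} (hE : 1 ≤ E)
    (hM : ∀ ε : ℝ, 0 < ε → ∃ C : ℝ, 0 ≤ C ∧ ∀ a N : ℕ,
      ∫ x in (0 : ℝ)..1, ‖∑ n ∈ Finset.Ico a (a + N), unitExp x (g n)‖ ^ (2 * k) ≤
        C * (N : ℝ) ^ (E + ε)) :
    dimH {x : ℝ | x ∈ Set.Icc (0 : ℝ) 1 ∧
      {N : ℕ | 1 ≤ N ∧ (N : ℝ) ^ α ≤ ‖∑ n ∈ Finset.range N, unitExp x (g n)‖}.Infinite} ≤
      ENNReal.ofReal (1 + (E - 2 * k * α) / (τ + 1 - α)) := by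
  set F := {x : ℝ | x ∈ Set.Icc (0 : ℝ) 1 ∧
      {N : ℕ | 1 ≤ N ∧ (N : ℝ) ^ α ≤ ‖∑ n ∈ Finset.range N, unitExp x (g n)‖}.Infinite} with hF
  set γ := τ + 1 - α with hγ
  have hγ0 : 0 < γ := by linarith
  refine le_of_forall_gt fun c hc => ?_
  obtain ⟨s, hs0, hDs, hsc⟩ := ENNReal.lt_iff_exists_real_btwn.1 hc
  refine lt_of_le_of_lt ?_ hsc
  obtain ⟨hs, hDs⟩ := (ENNReal.ofReal_lt_ofReal_iff'.1 hDs).symm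
  rcases le_or_gt 1 s with h1s | hs1
  · calc dimH F ≤ dimH (Set.univ : Set ℝ) := dimH_mono (Set.subset_univ _)
      _ = ENNReal.ofReal 1 := by rw [Real.dimH_univ, ENNReal.ofReal_one]
      _ ≤ ENNReal.ofReal s := ENNReal.ofReal_le_ofReal h1s
  -- Up to η-losses, 2^{mΘ} is the s-dimensional size of the cover at scale 2^m. The losses total at
  -- most (4 + 2k)η = -Θ/2, so the decay 2^{mΘ/2} survives.
  set Θ := (1 - s) * γ + E - 2 * k * α with hΘ
  have hΘ0 : Θ < 0 := by
    have : (E - 2 * k * α) / γ < s - 1 := by linarith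
    rw [div_lt_iff₀ hγ0] at this
    rw [hΘ]; linarith
  set η := -Θ / (2 * (4 + 2 * k)) with hη
  have hη0 : 0 < η := div_pos (by linarith) (by positivity)
  obtain ⟨C, hC0, hC⟩ := hM η hη0
  set b : ℝ := (2 : ℝ) ^ η with hb
  have hb1 : 1 < b := Real.one_lt_rpow one_lt_two hη0
  have hpow : ∀ (m : ℕ) (e : ℝ), ((2 : ℝ) ^ m) ^ e = ((2 : ℝ) ^ e) ^ m := fun m e =>
    (Real.rpow_pow_comm zero_le_two e m).symm
  obtain ⟨m₀, hm₀⟩ := eventually_atTop.1 ((eventually_two_mul_add_one_lt_pow hb1).and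
    (((tendsto_pow_atTop_atTop_of_one_lt hb1).eventually_ge_atTop (4 * Real.pi * |G|)).and
      (eventually_ge_atTop N₀)))
  -- One η compensates the lowering of V below 2^{mα}; the other absorbs the constant 4π|G|.
  set Q : ℕ → ℕ := fun m => ⌈((2 : ℝ) ^ m) ^ (γ + 2 * η)⌉₊ with hQ
  have hY1 : ∀ m : ℕ, (1 : ℝ) ≤ ((2 : ℝ) ^ m) ^ (γ + 2 * η) := fun m =>
    Real.one_le_rpow (one_le_pow₀ one_le_two) (by positivity)
  have hQY : ∀ m, ((2 : ℝ) ^ m) ^ (γ + 2 * η) ≤ Q m := fun m => Nat.le_ceil _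
  have hQpos : ∀ m, 0 < Q m := fun m => Nat.ceil_pos.2 (by linarith [hY1 m])
  have hQ2 : ∀ m, (Q m : ℝ) ≤ 2 * ((2 : ℝ) ^ m) ^ (γ + 2 * η) := fun m => by
    have := Nat.ceil_lt_add_one (a := ((2 : ℝ) ^ m) ^ (γ + 2 * η)) (by positivity)
    have := hY1 m
    simp only [hQ]
    linarith
  -- The lost factor 2^{mη} exceeds 2(m + 1): m + 1 from the dyadic decomposition, 2 from replacing
  -- N by the next power of two.
  set V : ℕ → ℝ := fun m => ((2 : ℝ) ^ m) ^ (α - η) with hV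
  have hVpos : ∀ m, 0 < V m := fun m => by positivity
  have hcover : ∀ m, ∃ B : Finset ℕ, m₀ ≤ m →
      (B.card : ℝ) ≤ (m + 1) * (Q m * (2 / V m) ^ (2 * k) * (C * ((2 : ℝ) ^ m) ^ (E + η))) ∧
      ∀ x ∈ Set.Icc (0 : ℝ) 1, ∀ N ≤ 2 ^ m,
        (m + 1) * V m < ‖∑ n ∈ Finset.range N, unitExp x (g n)‖ →
        ∃ i ∈ B, x ∈ Set.Icc ((i : ℝ) / Q m) (((i : ℝ) + 1) / Q m) := by
    intro m
    by_cases hm : m₀ ≤ m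
    · obtain ⟨-, h2, h3⟩ := hm₀ m hm
      have h4 : 2 * Real.pi * (∑ n ∈ Finset.range (2 ^ m), |(g n : ℝ)|) ≤ Q m * (V m / 2) := by
        have h5 := hG (2 ^ m) (h3.trans Nat.lt_two_pow_self.le)
        push_cast at h5
        have hX : (0 : ℝ) < 2 ^ m := by positivity
        calc 2 * Real.pi * (∑ n ∈ Finset.range (2 ^ m), |(g n : ℝ)|)
            ≤ 2 * Real.pi * (|G| * ((2 : ℝ) ^ m) ^ (τ + 1)) := by
              gcongr
              exact h5.trans (mul_le_mul_of_nonneg_right (le_abs_self G) (by positivity))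
          _ = (4 * Real.pi * |G|) * ((2 : ℝ) ^ m) ^ (τ + 1) / 2 := by ring
          _ ≤ b ^ m * ((2 : ℝ) ^ m) ^ (τ + 1) / 2 := by gcongr
          _ = ((2 : ℝ) ^ m) ^ (γ + 2 * η) * (V m / 2) := by
              rw [hb, ← hpow, ← Real.rpow_add hX, ← mul_div_assoc, ← Real.rpow_add hX]
              congr 2
              rw [hγ]; ring
          _ ≤ _ := by
              have := hVpos m
              have := hQY m
              gcongr
      obtain ⟨B, hB⟩ := exists_cover_of_moment (by linarith) hC0 hC (hVpos m) (hQpos m) h4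
      exact ⟨B, fun _ => hB⟩
    · exact ⟨∅, fun h => absurd h hm⟩
  choose B' hB' using hcover
  set θ : ℝ := (2 : ℝ) ^ (-(γ + 2 * η)) with hθ
  refine dimH_le_of_frequently_mem (θ := θ) (ρ := (2 : ℝ) ^ (Θ / 2)) (K := 2 * 4 ^ k * C) hs
    (by positivity) (Real.rpow_lt_one_of_one_lt_of_neg one_lt_two (by linarith)) (by positivity)
    (Real.rpow_lt_one_of_one_lt_of_neg one_lt_two (by linarith)) (by positivity) (B := B')
    (t := fun m i => Set.Icc ((i : ℝ) / Q m) (((i : ℝ) + 1) / Q m)) (δ := fun m => 1 / (Q m : ℝ))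
    m₀ (fun m => by positivity) (fun m => ?_) (fun m i _ => ?_) (fun m hm => ?_) (fun x hx => ?_)
  · rw [hθ, ← hpow, Real.rpow_neg (by positivity), one_div]
    have := hY1 m
    have := hQY m
    gcongr
  · rw [Real.ediam_Icc]
    exact le_of_eq (by congr 1; ring)
  · have hX : (0 : ℝ) < 2 ^ m := by positivity
    have hQ0 : (0 : ℝ) < Q m := by exact_mod_cast hQpos m
    have h1 : ((m : ℝ) + 1) ≤ ((2 : ℝ) ^ m) ^ η := by
      have := (hm₀ m hm).1
      rw [hb, ← hpow] at this
      have : (0 : ℝ) ≤ (m : ℝ) + 1 := by positivity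
      linarith
    have h2 : (Q m : ℝ) * (1 / (Q m : ℝ)) ^ s ≤ 2 * ((2 : ℝ) ^ m) ^ ((γ + 2 * η) * (1 - s)) := by
      calc (Q m : ℝ) * (1 / (Q m : ℝ)) ^ s = (Q m : ℝ) ^ (1 - s) := by
            rw [one_div, Real.inv_rpow hQ0.le, Real.rpow_sub hQ0, Real.rpow_one, div_eq_mul_inv]
        _ ≤ (2 * ((2 : ℝ) ^ m) ^ (γ + 2 * η)) ^ (1 - s) := by
            have := hQ2 m
            gcongr
        _ = (2 : ℝ) ^ (1 - s) * ((2 : ℝ) ^ m) ^ ((γ + 2 * η) * (1 - s)) := by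
            rw [Real.mul_rpow zero_le_two (by positivity), ← Real.rpow_mul hX.le]
        _ ≤ (2 : ℝ) ^ (1 : ℝ) * ((2 : ℝ) ^ m) ^ ((γ + 2 * η) * (1 - s)) := by
            gcongr
            · exact one_le_two
            · linarith
        _ = _ := by rw [Real.rpow_one]
    have h3 : (2 / V m) ^ (2 * k) = 4 ^ k * ((2 : ℝ) ^ m) ^ (-(2 * k * (α - η))) := by
      rw [div_pow, pow_mul 2 2 k, Real.rpow_neg hX.le, hV, ← Real.rpow_mul_natCast hX.le,
        div_eq_mul_inv]
      norm_num
      ring_nf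
    have h4 : ((2 : ℝ) ^ (Θ / 2)) ^ m = ((2 : ℝ) ^ m) ^ (Θ / 2) := (hpow _ _).symm
    calc ((B' m).card : ℝ) * (1 / (Q m : ℝ)) ^ s
        ≤ ((m + 1) * (Q m * (2 / V m) ^ (2 * k) * (C * ((2 : ℝ) ^ m) ^ (E + η)))) *
          (1 / (Q m : ℝ)) ^ s := by
          gcongr; exact (hB' m hm).1
      _ = (m + 1) * (2 / V m) ^ (2 * k) * (C * ((2 : ℝ) ^ m) ^ (E + η)) *
          (Q m * (1 / (Q m : ℝ)) ^ s) := by ring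
      _ ≤ ((2 : ℝ) ^ m) ^ η * (2 / V m) ^ (2 * k) * (C * ((2 : ℝ) ^ m) ^ (E + η)) *
          (2 * ((2 : ℝ) ^ m) ^ ((γ + 2 * η) * (1 - s))) := by
          have := hVpos m
          gcongr
      _ = 2 * 4 ^ k * C * (((2 : ℝ) ^ m) ^ η * ((2 : ℝ) ^ m) ^ (-(2 * k * (α - η))) *
          ((2 : ℝ) ^ m) ^ (E + η) * ((2 : ℝ) ^ m) ^ ((γ + 2 * η) * (1 - s))) := by
          rw [h3]; ring
      _ ≤ 2 * 4 ^ k * C * ((2 : ℝ) ^ (Θ / 2)) ^ m := by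
          rw [h4, ← Real.rpow_add hX, ← Real.rpow_add hX, ← Real.rpow_add hX]
          gcongr
          · exact one_le_pow₀ one_le_two
          · have h5 : η * (2 * (4 + 2 * k)) = -Θ := by rw [hη]; field_simp
            have h6 : 0 < η * s := mul_pos hη0 hs
            rw [hΘ] at h5 ⊢
            nlinarith
  · rw [hF] at hx
    obtain ⟨hx01, hinf⟩ := hx
    refine frequently_atTop.2 fun m₁ => ?_
    obtain ⟨N, ⟨hN1, hN⟩, hNlt⟩ := hinf.exists_gt (2 ^ (max m₀ m₁))
    set m := Nat.log 2 N + 1 with hm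
    have hNm : N < 2 ^ m := Nat.lt_pow_succ_log_self one_lt_two _
    have hmN : 2 ^ m ≤ 2 * N := by
      rw [hm, pow_succ, mul_comm]
      exact Nat.mul_le_mul_left _ (Nat.pow_log_le_self 2 (by omega))
    have hmax : max m₀ m₁ ≤ m :=
      ((Nat.pow_lt_pow_iff_right one_lt_two).1 (hNlt.trans hNm)).le
    have hm0 : m₀ ≤ m := (le_max_left _ _).trans hmax
    refine ⟨m, (le_max_right _ _).trans hmax, (hB' m hm0).2 x hx01 N hNm.le ?_⟩
    refine lt_of_lt_of_le ?_ hN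
    have hX : (0 : ℝ) < 2 ^ m := by positivity
    have h1 := (hm₀ m hm0).1
    rw [hb, ← hpow] at h1
    have h2 : (2 : ℝ) ^ m ≤ 2 * N := by exact_mod_cast hmN
    have h3 : ((2 : ℝ) ^ m) ^ α ≤ 2 * (N : ℝ) ^ α := by
      calc ((2 : ℝ) ^ m) ^ α ≤ (2 * (N : ℝ)) ^ α := by gcongr
        _ = (2 : ℝ) ^ α * (N : ℝ) ^ α := Real.mul_rpow zero_le_two (by positivity)
        _ ≤ (2 : ℝ) ^ (1 : ℝ) * (N : ℝ) ^ α := by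
          gcongr
          exact one_le_two
        _ = _ := by rw [Real.rpow_one]
    have h4 : ((2 : ℝ) ^ m) ^ α = ((2 : ℝ) ^ m) ^ η * V m := by
      rw [hV, ← Real.rpow_add hX]; congr 1; ring
    have h5 := mul_lt_mul_of_pos_right h1 (hVpos m)
    linarith

theorem dimH_largeSumSet_le {f : ℕ → ℤ} (hconv : IsStrictlyConvexSeq (fun n => (f n : ℝ)))
    {τ : ℝ} (hτ : 0 < τ) (hgrowth : HasAverageGrowth (fun n => (f n : ℝ)) τ)
    {α : ℝ} (hα : α ∈ Set.Ioo (1 / 2 : ℝ) 1) {k : ℕ} (hk : k ≠ 0) {E : ℝ} (hE : 1 ≤ E)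
    (hM : SetMomentBound k E) :
    dimH (largeSumSet (fun n => (f n : ℝ)) α) ≤
      ENNReal.ofReal (1 + (E - 2 * k * α) / (τ + 1 - α)) := by
  have hg : StrictMono fun n => f (n + 1 + 1) - f (n + 1) := by
    refine strictMono_nat_of_lt_succ fun n => ?_
    have : (f (n + 1 + 1) : ℝ) - f (n + 1) < f (n + 1 + 2) - f (n + 1 + 1) :=
      hconv (n + 1) (by omega)
    exact_mod_cast this
  have hsum : ∀ {R : Type} [AddCommMonoid R] (u : ℕ → R) (N : ℕ),
      ∑ n ∈ Finset.Icc 1 N, u n = ∑ n ∈ Finset.range N, u (n + 1) := by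
    intro R _ u N
    rw [Finset.range_eq_Ico, Finset.sum_Ico_add' u 0 N 1, zero_add, Finset.Ico_add_one_right_eq_Icc]
  obtain ⟨C, N₀, hN₀, hC⟩ := hgrowth
  have hG : ∀ N : ℕ, N₀ ≤ N →
      ∑ n ∈ Finset.range N, |(f (n + 1) : ℝ)| ≤ C * (N : ℝ) ^ (τ + 1) := by
    intro N hN
    have hN0 : (0 : ℝ) < N := by exact_mod_cast (by omega : 0 < N)
    have := hC N hN
    rw [hsum, one_div, inv_mul_le_iff₀ hN0] at this
    rw [Real.rpow_add hN0, Real.rpow_one]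
    linarith
  -- The index shift makes the sequence start at 0, so convexity holds at every index and f 0 never
  -- enters.
  have h := dimH_le_of_moment (g := fun n => f (n + 1)) hα.2 hτ (by linarith [hα.1]) hG hE
    (fun ε hε => exists_integral_block_le hg hk (by linarith) hM hε)
  convert h using 2
  ext x
  simp only [largeSumSet, expSum, hsum, unitExp]

theorem theorem3p6 (f : ℕ → ℤ) (hconv : IsStrictlyConvexSeq (fun n => (f n : ℝ)))
    (τ : ℝ) (hτ : 0 < τ) (hgrowth : HasAverageGrowth (fun n => (f n : ℝ)) τ)
    (α : ℝ) (hα : α ∈ Set.Ioo (1 / 2 : ℝ) 1) :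
    dimH (largeSumSet (fun n => (f n : ℝ)) α) ≤
      ENNReal.ofReal (min (dimBoundOne τ α) (dimBoundTwo τ α)) := by
  have hγ : τ + 1 - α ≠ 0 := by have := hα.2; intro h; linarith
  have h1 : dimH (largeSumSet (fun n => (f n : ℝ)) α) ≤ ENNReal.ofReal (dimBoundOne τ α) := by
    have h := dimH_largeSumSet_le hconv hτ hgrowth hα two_ne_zero (by norm_num)
      setMomentBound_two
    convert h using 2
    rw [dimBoundOne]
    field_simp
    push_cast
    ring
  have h2 : ∀ k : {k : ℕ // 3 ≤ k}, dimH (largeSumSet (fun n => (f n : ℝ)) α) ≤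
      ENNReal.ofReal ((τ - α + 2 * (k : ℝ) - 1 + (2 : ℝ) ^ (-(k : ℝ) + 1) - 2 * (k : ℝ) * α) /
        (τ + 1 - α)) := by
    rintro ⟨k, hk⟩
    have hk' : (3 : ℝ) ≤ k := by exact_mod_cast hk
    have h := dimH_largeSumSet_le hconv hτ hgrowth hα (k := k) (by omega)
      (by have : (0 : ℝ) < (1 / 2) ^ k := by positivity
          linarith) (setMomentBound k)
    convert h using 2
    have : (2 : ℝ) ^ (-(k : ℝ) + 1) = 2 * (1 / 2) ^ k := by
      rw [Real.rpow_add two_pos, Real.rpow_neg zero_le_two, Real.rpow_natCast, Real.rpow_one,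
        one_div, inv_pow]
      ring
    simp only [this]
    field_simp
    ring
  rcases le_total (dimBoundOne τ α) (dimBoundTwo τ α) with h | h
  · rwa [min_eq_left h]
  · rw [min_eq_right h]
    -- The infimum is approached through a real s above it, so its attainment is not needed: some k
    -- has its term below s.
    refine le_of_forall_gt fun c hc => ?_
    obtain ⟨s, -, hs, hsc⟩ := ENNReal.lt_iff_exists_real_btwn.1 hc
    refine lt_of_le_of_lt ?_ hsc
    have : Nonempty {k : ℕ // 3 ≤ k} := ⟨⟨3, le_rfl⟩⟩
    obtain ⟨k, hk⟩ := exists_lt_of_ciInf_lt (ENNReal.ofReal_lt_ofReal_iff'.1 hs).1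
    exact (h2 k).trans (ENNReal.ofReal_le_ofReal hk.le)
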